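/- **Setting.** Modal formulae are built from countably many propositional variables with $\bot,\top,\neg,\wedge,\vee,\to$ and modalities $\Box_m$. Fix relation symbols $\rho$, each relating a state variable to a tuple of state variables (such as $xRy$, $xR_{\mathsf m}y$, $xR_{\mathsf e}(y,z)$); the tuple is called the last component of the relation term. An *end-active labelled line sequent* $\mathcal R,\Gamma\Rightarrow\Delta$ consists of a single relation term $\mathcal R$ and finite multisets $\Gamma,\Delta$ of labelled formulae $x:A$ ($x$ a state variable). An *end-active LLS rule* is given by a schematic relation term and finitely many schematic active labelled formulae in the conclusion, and the same data for each of finitely many premisses, such that the active formulae of the conclusion carry labels of its relation term, the active formulae of a premiss carry labels of the last component of the premiss's relation term, and the labels of a premiss either belong to the relation term of the conclusion or are fresh. Schematic formulae may contain formula metavariables and propositional variables (so $\mathsf{init}$ is the family of rules $\mathsf{init}_p$, $p$ a propositional variable). In an instance, arbitrary side contexts $X\Rightarrow Y$ are added to the conclusion and copied to all premisses, and the fresh labels are pairwise distinct and do not occur in the conclusion. An *LLS system* $L$ is a (possibly infinite) set of end-active LLS rules. **Focused linear logic.** LLF is the focused proof system for one-sided first-order linear logic (connectives $1,0,\top,\bot,\otimes,⅋,\&,\oplus,\exists,\forall,?,!$,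 with quantifiers over labels and over object-level formulae) whose atoms, of negative polarity, are $\lfloor x:A\rfloor$, $\lceil x:A\rceil$ and $\rho(x_0,\dots,x_k)$. Its judgements are $\vdash\Theta;\Gamma\Uparrow\Lambda$ and $\vdash\Theta;\Gamma\Downarrow F$, with $\Theta$ the unbounded and $\Gamma$ the linear context. A *monopole* is built from atoms with the negative connectives $\top,\bot,⅋,\&,\forall,?$, where $?$ is applied to atoms only. A *bipole* is a positive formula built from monopoles and negated atoms with the positive connectives, where $!$ is applied to monopoles only. Write $\mathrm{enc}(S)$ for the multiset $\mathcal R,\lfloor\Gamma\rfloor,\lceil\Delta\rceil$ of atoms, where $S$ is the sequent $\mathcal R,\Gamma\Rightarrow\Delta$. **Adequate specifications.** A specification of a set $L_0$ of rules assigns to every $r\in L_0$ a bipole $C_r$ without free state variables (its clause); its theory is $\mathcal L_0=\{C_r : r\in L_0\}$. It is *adequate* if focusing on $C_r$ amounts to applying $r$: for every $r\in L_0$, every sequent $S$, and every set $H$ of judgements $\vdash\Theta;\Gamma\Uparrow\cdot$ closed under bijective renamings of state variables, $S$ is the conclusion of an instance of $r$ such that $(\vdash\mathcal L_0;\mathrm{enc}(P)\Uparrow\cdot)\in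 H$ for each of its premisses $P$ if and only if $\vdash\mathcal L_0;\mathrm{enc}(S)\Downarrow C_r$ has an open LLF derivation without decision rules (one positive phase followed by one negative phase) all of whose open leaves lie in $H$. **Theorem.** Let $L$ be an LLS system and $\mathcal R,\Gamma\Rightarrow\Delta$ an end-active labelled line sequent. 1. $\mathcal R,\Gamma\Rightarrow\Delta$ is provable in $L$ if and only if there are a finite $L_0\subseteq L$ and an adequate specification of the rules of $L_0$, with theory $\mathcal L_0$, such that $\vdash\mathcal L_0;\mathcal R\Uparrow\lfloor\Gamma\rfloor,\lceil\Delta\rceil$ is provable in LLF. 2. Every finite $L_0\subseteq L$ has an adequate specification, and for each such specification, with theory $\mathcal L_0$, $\vdash\mathcal L_0;\mathcal R\Uparrow\lfloor\Gamma\rfloor,\lceil\Delta\rceil$ is provable in LLF if and only if $\mathcal R,\Gamma\Rightarrow\Delta$ is provable in $L_0$. -/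

import Mathlib

namespace LLSpec

/-! ### Open derivations in an arbitrary rule system -/

/-- `Derivable R H a`: there is a finite derivation tree with root `a`, built with the rule
instances `R` (a list of premisses and a conclusion), all of whose open leaves lie in `H`.
`Derivable R ∅ a` is provability. -/
inductive Derivable {α : Type*} (R : List α → α → Prop) (H : Set α) : α → Prop
  | hyp {a : α} : a ∈ H → Derivable R H a
  | rule {ps : List α} {a : α} : R ps a → (∀ p ∈ ps, Derivable R H p) → Derivable R H a

/-! ### Object level: modal formulae, labelled sequents, labelled line sequent rules -/

/-- Indices of the modalities, and relation symbols of the labelled sequents. The relation symbol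
`r` relates one label to `ar r` labels: `ar r = 1` for `x R y` and `x R_m y`, and `ar r = 2` for
`x R_e (y, z)`. -/
structure Signature where
  Mod : Type
  Rel : Type
  ar : Rel → ℕ

/-- Modal formulae with `n` formula variables (schematic, or bound by a meta-level quantifier).
The formulae of the object logic are those of `Fml M 0`. -/
inductive Fml (M : Type) : ℕ → Type
  | prop {n : ℕ} (p : ℕ) : Fml M n
  | var {n : ℕ} (i : Fin n) : Fml M n
  | bot {n : ℕ} : Fml M n
  | top {n : ℕ} : Fml M n
  | neg {n : ℕ} (A : Fml M n) : Fml M n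
  | and {n : ℕ} (A B : Fml M n) : Fml M n
  | or {n : ℕ} (A B : Fml M n) : Fml M n
  | imp {n : ℕ} (A B : Fml M n) : Fml M n
  | box {n : ℕ} (m : M) (A : Fml M n) : Fml M n

/-- Simultaneous substitution for the formula variables. -/
def Fml.subst {M : Type} {n k : ℕ} (t : Fin n → Fml M k) : Fml M n → Fml M k
  | .prop p => .prop p
  | .var i => t i
  | .bot => .bot
  | .top => .top
  | .neg A => .neg (A.subst t)
  | .and A B => .and (A.subst t) (B.subst t)
  | .or A B => .or (A.subst t) (B.subst t)
  | .imp A B => .imp (A.subst t) (B.subst t)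
  | .box m A => .box m (A.subst t)

/-- The propositional variable `p` does not occur in the formula. -/
def Fml.Fresh {M : Type} {n : ℕ} (p : ℕ) : Fml M n → Prop
  | .prop q => p ≠ q
  | .var _ => True
  | .bot => True
  | .top => True
  | .neg A => A.Fresh p
  | .and A B => A.Fresh p ∧ B.Fresh p
  | .or A B => A.Fresh p ∧ B.Fresh p
  | .imp A B => A.Fresh p ∧ B.Fresh p
  | .box _ A => A.Fresh p

/-- An end-active labelled line sequent `r(args), left ⇒ right`: a single relation term and two
multisets of labelled formulae. State variables are natural numbers; `args 0` is the first
argument of the relation term, the other arguments label its last component(s). -/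
structure LSeq (σ : Signature) where
  rel : σ.Rel
  args : Fin (σ.ar rel + 1) → ℕ
  left : Multiset (ℕ × Fml σ.Mod 0)
  right : Multiset (ℕ × Fml σ.Mod 0)

/-- The state variables that occur in a sequent. -/
def LSeq.labels {σ : Signature} (S : LSeq σ) : Set ℕ :=
  Set.range S.args ∪ {x | ∃ A, (x, A) ∈ S.left ∨ (x, A) ∈ S.right}

/-- A premiss of an end-active rule whose conclusion has `k` labels in its relation term, with
`e` fresh labels and `n` schematic formula variables. Its relation term is made of labels of the
conclusion (`Sum.inl`) and fresh labels (`Sum.inr`). The active formulae are labelled with the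
last component of its relation term: `(i, A)` stands for `args i.succ : A`. -/
structure LLSPremise (σ : Signature) (k e n : ℕ) where
  rel : σ.Rel
  args : Fin (σ.ar rel + 1) → Fin k ⊕ Fin e
  left : List (Fin (σ.ar rel) × Fml σ.Mod n)
  right : List (Fin (σ.ar rel) × Fml σ.Mod n)

/-- An end-active labelled line sequent rule: schematic relation terms and finitely many schematic
active formulae in the conclusion and in each premiss. The active formulae of the conclusion carry
labels of its relation term. The contexts `X ⇒ Y` are not displayed, see `LLSRule.Inst`. -/
structure LLSRule (σ : Signature) where
  numFml : ℕ
  numFresh : ℕ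
  rel : σ.Rel
  left : List (Fin (σ.ar rel + 1) × Fml σ.Mod numFml)
  right : List (Fin (σ.ar rel + 1) × Fml σ.Mod numFml)
  prems : List (LLSPremise σ (σ.ar rel + 1) numFresh numFml)

/-- Instance of a premiss for the given labels, fresh labels, formulae and contexts. -/
def LLSPremise.inst {σ : Signature} {k e n : ℕ} (P : LLSPremise σ k e n)
    (lab : Fin k → ℕ) (new : Fin e → ℕ) (fm : Fin n → Fml σ.Mod 0)
    (X Y : Multiset (ℕ × Fml σ.Mod 0)) : LSeq σ where
  rel := P.rel
  args := fun i => Sum.elim lab new (P.args i)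
  left := X + (P.left.map fun a => (Sum.elim lab new (P.args a.1.succ), a.2.subst fm) : List _)
  right := Y + (P.right.map fun a => (Sum.elim lab new (P.args a.1.succ), a.2.subst fm) : List _)

/-- Instance of the conclusion of a rule. -/
def LLSRule.concl {σ : Signature} (r : LLSRule σ)
    (lab : Fin (σ.ar r.rel + 1) → ℕ) (fm : Fin r.numFml → Fml σ.Mod 0)
    (X Y : Multiset (ℕ × Fml σ.Mod 0)) : LSeq σ where
  rel := r.rel
  args := lab
  left := X + (r.left.map fun a => (lab a.1, a.2.subst fm) : List _)
  right := Y + (r.right.map fun a => (lab a.1, a.2.subst fm) : List _)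

/-- `ps / S` is an instance of the rule: arbitrary contexts `X`, `Y` are copied to all premisses,
and the fresh labels are pairwise distinct and do not occur in the conclusion. -/
def LLSRule.Inst {σ : Signature} (r : LLSRule σ) (ps : List (LSeq σ)) (S : LSeq σ) : Prop :=
  ∃ (lab : Fin (σ.ar r.rel + 1) → ℕ) (new : Fin r.numFresh → ℕ)
    (fm : Fin r.numFml → Fml σ.Mod 0) (X Y : Multiset (ℕ × Fml σ.Mod 0)),
    S = r.concl lab fm X Y ∧
    Function.Injective new ∧ (∀ j, new j ∉ S.labels) ∧
    ps = r.prems.map fun P => P.inst lab new fm X Y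

/-- Provability in the labelled line sequent system with the set `L` of rules. -/
def Provable {σ : Signature} (L : Set (LLSRule σ)) (S : LSeq σ) : Prop :=
  Derivable (fun ps T => ∃ r ∈ L, r.Inst ps T) ∅ S

/-! ### Meta level: linear logic formulae

Quantifiers range over two sorts: labels, and object-level formulae. Formulae are well scoped:
`LL σ l f` has `l` label variables and `f` formula variables in scope (de Bruijn indices), and
`LL σ 0 0` are the formulae without dangling variables. -/

/-- Label terms: state variables, and bound variables. -/
inductive LTm (l : ℕ) : Type
  | name (x : ℕ) : LTm l
  | bvar (i : Fin l) : LTm l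

/-- The meta-level atoms `⌊x : A⌋`, `⌈x : A⌉` and `r(x₀, …, xₖ)`. -/
inductive Atom (σ : Signature) (l f : ℕ) : Type
  | lft (x : LTm l) (A : Fml σ.Mod f) : Atom σ l f
  | rght (x : LTm l) (A : Fml σ.Mod f) : Atom σ l f
  | rel (r : σ.Rel) (args : Fin (σ.ar r + 1) → LTm l) : Atom σ l f

/-- Formulae of linear logic in negation normal form. -/
inductive LL (σ : Signature) : ℕ → ℕ → Type
  | atom {l f : ℕ} (a : Atom σ l f) : LL σ l f
  | natom {l f : ℕ} (a : Atom σ l f) : LL σ l f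
  | one {l f : ℕ} : LL σ l f
  | zero {l f : ℕ} : LL σ l f
  | top {l f : ℕ} : LL σ l f
  | bot {l f : ℕ} : LL σ l f
  | tensor {l f : ℕ} (F G : LL σ l f) : LL σ l f
  | par {l f : ℕ} (F G : LL σ l f) : LL σ l f
  | wth {l f : ℕ} (F G : LL σ l f) : LL σ l f
  | plus {l f : ℕ} (F G : LL σ l f) : LL σ l f
  | exLab {l f : ℕ} (F : LL σ (l + 1) f) : LL σ l f
  | exFml {l f : ℕ} (F : LL σ l (f + 1)) : LL σ l f
  | allLab {l f : ℕ} (F : LL σ (l + 1) f) : LL σ l f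
  | allFml {l f : ℕ} (F : LL σ l (f + 1)) : LL σ l f
  | quest {l f : ℕ} (F : LL σ l f) : LL σ l f
  | bang {l f : ℕ} (F : LL σ l f) : LL σ l f

/-- Apply `g` to the state variables and substitute `s` for the bound label variables. -/
def LTm.subst {l l' : ℕ} (g : ℕ → ℕ) (s : Fin l → LTm l') : LTm l → LTm l'
  | .name x => .name (g x)
  | .bvar i => s i

def Atom.subst {σ : Signature} {l l' f f' : ℕ} (g : ℕ → ℕ) (s : Fin l → LTm l')
    (t : Fin f → Fml σ.Mod f') : Atom σ l f → Atom σ l' f'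
  | .lft x A => .lft (x.subst g s) (A.subst t)
  | .rght x A => .rght (x.subst g s) (A.subst t)
  | .rel r args => .rel r fun i => (args i).subst g s

/-- Lifting of a substitution under a binder for a label. -/
def liftLab {l l' : ℕ} (s : Fin l → LTm l') : Fin (l + 1) → LTm (l' + 1) :=
  Fin.cons (.bvar 0) fun i => (s i).subst id fun j => .bvar j.succ

/-- Lifting of a substitution under a binder for a formula. -/
def liftFml {M : Type} {f f' : ℕ} (t : Fin f → Fml M f') : Fin (f + 1) → Fml M (f' + 1) :=
  Fin.cons (.var 0) fun i => (t i).subst fun j => .var j.succ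

/-- Simultaneous renaming of state variables and substitution for label and formula variables. -/
def LL.subst {σ : Signature} {l l' f f' : ℕ} (g : ℕ → ℕ) (s : Fin l → LTm l')
    (t : Fin f → Fml σ.Mod f') : LL σ l f → LL σ l' f'
  | .atom a => .atom (a.subst g s t)
  | .natom a => .natom (a.subst g s t)
  | .one => .one
  | .zero => .zero
  | .top => .top
  | .bot => .bot
  | .tensor F G => .tensor (F.subst g s t) (G.subst g s t)
  | .par F G => .par (F.subst g s t) (G.subst g s t)
  | .wth F G => .wth (F.subst g s t) (G.subst g s t)
  | .plus F G => .plus (F.subst g s t) (G.subst g s t)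
  | .exLab F => .exLab (F.subst g (liftLab s) t)
  | .exFml F => .exFml (F.subst g s (liftFml t))
  | .allLab F => .allLab (F.subst g (liftLab s) t)
  | .allFml F => .allFml (F.subst g s (liftFml t))
  | .quest F => .quest (F.subst g s t)
  | .bang F => .bang (F.subst g s t)

/-- `F[x / y]` for the outermost label variable `y`. -/
def LL.instLab {σ : Signature} (F : LL σ 1 0) (x : ℕ) : LL σ 0 0 :=
  F.subst id (fun _ => .name x) .var

/-- `F[A / B]` for the outermost formula variable `B`. -/
def LL.instFml {σ : Signature} (F : LL σ 0 1) (A : Fml σ.Mod 0) : LL σ 0 0 :=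
  F.subst id .bvar (fun _ => A)

/-- Renaming of the state variables. -/
def LL.rename {σ : Signature} (g : ℕ → ℕ) (F : LL σ 0 0) : LL σ 0 0 :=
  F.subst g .bvar .var

/-- The state variable `y` does not occur in the label term. -/
def LTm.FreshLab {l : ℕ} (y : ℕ) : LTm l → Prop
  | .name x => y ≠ x
  | .bvar _ => True

def Atom.FreshLab {σ : Signature} {l f : ℕ} (y : ℕ) : Atom σ l f → Prop
  | .lft x _ => x.FreshLab y
  | .rght x _ => x.FreshLab y
  | .rel _ args => ∀ i, (args i).FreshLab y

/-- The propositional variable `p` does not occur in the atom. -/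
def Atom.FreshProp {σ : Signature} {l f : ℕ} (p : ℕ) : Atom σ l f → Prop
  | .lft _ A => A.Fresh p
  | .rght _ A => A.Fresh p
  | .rel _ _ => True

/-- `Q` holds of all atoms that occur in the formula. -/
def LL.AllAtoms {σ : Signature} (Q : ∀ l f : ℕ, Atom σ l f → Prop) {l f : ℕ} : LL σ l f → Prop
  | .atom a => Q _ _ a
  | .natom a => Q _ _ a
  | .one => True
  | .zero => True
  | .top => True
  | .bot => True
  | .tensor F G => F.AllAtoms Q ∧ G.AllAtoms Q
  | .par F G => F.AllAtoms Q ∧ G.AllAtoms Q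
  | .wth F G => F.AllAtoms Q ∧ G.AllAtoms Q
  | .plus F G => F.AllAtoms Q ∧ G.AllAtoms Q
  | .exLab F => F.AllAtoms Q
  | .exFml F => F.AllAtoms Q
  | .allLab F => F.AllAtoms Q
  | .allFml F => F.AllAtoms Q
  | .quest F => F.AllAtoms Q
  | .bang F => F.AllAtoms Q

/-- The state variable `y` does not occur in `F`. -/
def LL.FreshLab {σ : Signature} {l f : ℕ} (y : ℕ) (F : LL σ l f) : Prop :=
  F.AllAtoms fun _ _ a => a.FreshLab y

/-- The propositional variable `p` does not occur in `F`. -/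
def LL.FreshProp {σ : Signature} {l f : ℕ} (p : ℕ) (F : LL σ l f) : Prop :=
  F.AllAtoms fun _ _ a => a.FreshProp p

/-! ### Focused linear logic -/

/-- `F` is an atom. -/
def LL.IsAtom {σ : Signature} {l f : ℕ} : LL σ l f → Prop
  | .atom _ => True
  | _ => False

/-- Negative formulae: the outermost connective is negative, or the formula is an atom. -/
def LL.IsNegative {σ : Signature} {l f : ℕ} : LL σ l f → Prop
  | .atom _ => True
  | .top => True
  | .bot => True
  | .par _ _ => True
  | .wth _ _ => True
  | .allLab _ => True
  | .allFml _ => True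
  | .quest _ => True
  | _ => False

/-- Positive formulae: the outermost connective is positive, or the formula is a negated atom. -/
def LL.IsPositive {σ : Signature} {l f : ℕ} (F : LL σ l f) : Prop := ¬ F.IsNegative

/-- Judgements of LLF: `up Θ Γ L` is `⊢ Θ; Γ ⇑ L` and `down Θ Γ F` is `⊢ Θ; Γ ⇓ F`, where `Θ` is
the unbounded context and `Γ` the linear context. -/
inductive Judgement (σ : Signature) : Type
  | up (Θ : Set (LL σ 0 0)) (Γ : Multiset (LL σ 0 0)) (L : List (LL σ 0 0)) : Judgement σ
  | down (Θ : Set (LL σ 0 0)) (Γ : Multiset (LL σ 0 0)) (F : LL σ 0 0) : Judgement σ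

open Judgement in
/-- The rules of LLF other than the decision rules. The eigenvariables of sort label are state
variables, and those of the sort of object-level formulae are propositional variables. -/
inductive PhaseRule {σ : Signature} : List (Judgement σ) → Judgement σ → Prop
  -- negative phase
  | top {Θ Γ L} : PhaseRule [] (up Θ Γ (.top :: L))
  | bot {Θ Γ L} : PhaseRule [up Θ Γ L] (up Θ Γ (.bot :: L))
  | par {Θ Γ L F G} : PhaseRule [up Θ Γ (F :: G :: L)] (up Θ Γ (.par F G :: L))
  | wth {Θ Γ L F G} : PhaseRule [up Θ Γ (F :: L), up Θ Γ (G :: L)] (up Θ Γ (.wth F G :: L))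
  | quest {Θ Γ L F} : PhaseRule [up (insert F Θ) Γ L] (up Θ Γ (.quest F :: L))
  | allLab {Θ Γ L F} (y : ℕ) (hΘ : ∀ G ∈ Θ, G.FreshLab y) (hΓ : ∀ G ∈ Γ, G.FreshLab y)
      (hL : ∀ G ∈ L, G.FreshLab y) (hF : F.FreshLab y) :
      PhaseRule [up Θ Γ (F.instLab y :: L)] (up Θ Γ (.allLab F :: L))
  | allFml {Θ Γ L F} (p : ℕ) (hΘ : ∀ G ∈ Θ, G.FreshProp p) (hΓ : ∀ G ∈ Γ, G.FreshProp p)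
      (hL : ∀ G ∈ L, G.FreshProp p) (hF : F.FreshProp p) :
      PhaseRule [up Θ Γ (F.instFml (.prop p) :: L)] (up Θ Γ (.allFml F :: L))
  -- a positive formula or an atom is stored in the linear context
  | store {Θ Γ L F} (hF : F.IsPositive ∨ F.IsAtom) :
      PhaseRule [up Θ (F ::ₘ Γ) L] (up Θ Γ (F :: L))
  -- positive phase
  | one {Θ} : PhaseRule [] (down Θ 0 .one)
  | tensor {Θ Γ₁ Γ₂ F G} :
      PhaseRule [down Θ Γ₁ F, down Θ Γ₂ G] (down Θ (Γ₁ + Γ₂) (.tensor F G))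
  | plusLeft {Θ Γ F G} : PhaseRule [down Θ Γ F] (down Θ Γ (.plus F G))
  | plusRight {Θ Γ F G} : PhaseRule [down Θ Γ G] (down Θ Γ (.plus F G))
  | exLab {Θ Γ F} (x : ℕ) : PhaseRule [down Θ Γ (F.instLab x)] (down Θ Γ (.exLab F))
  | exFml {Θ Γ F} (A : Fml σ.Mod 0) : PhaseRule [down Θ Γ (F.instFml A)] (down Θ Γ (.exFml F))
  | bang {Θ F} : PhaseRule [up Θ 0 [F]] (down Θ 0 (.bang F))
  -- end of the positive phase
  | release {Θ Γ F} (hF : F.IsNegative) : PhaseRule [up Θ Γ [F]] (down Θ Γ F)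
  | init₁ {Θ a} : PhaseRule [] (down Θ {.atom a} (.natom a))
  | init₂ {Θ a} (ha : .atom a ∈ Θ) : PhaseRule [] (down Θ 0 (.natom a))

open Judgement in
/-- The rules of LLF. -/
inductive LLFRule {σ : Signature} : List (Judgement σ) → Judgement σ → Prop
  | phase {ps j} : PhaseRule ps j → LLFRule ps j
  | decide₁ {Θ Γ F} (hF : ¬ F.IsAtom) : LLFRule [down Θ Γ F] (up Θ (F ::ₘ Γ) [])
  | decide₂ {Θ Γ F} (hΘ : F ∈ Θ) (hF : ¬ F.IsAtom) : LLFRule [down Θ Γ F] (up Θ Γ [])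

/-- Provability in LLF. -/
def LLFProvable {σ : Signature} (j : Judgement σ) : Prop := Derivable LLFRule ∅ j

/-- Monopoles: built from atoms with the negative connectives, `?` having atomic scope. -/
inductive IsMonopole {σ : Signature} : ∀ {l f : ℕ}, LL σ l f → Prop
  | atom {l f} (a : Atom σ l f) : IsMonopole (.atom a)
  | top {l f} : IsMonopole (.top : LL σ l f)
  | bot {l f} : IsMonopole (.bot : LL σ l f)
  | par {l f} {F G : LL σ l f} : IsMonopole F → IsMonopole G → IsMonopole (.par F G)
  | wth {l f} {F G : LL σ l f} : IsMonopole F → IsMonopole G → IsMonopole (.wth F G)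
  | allLab {l f} {F : LL σ (l + 1) f} : IsMonopole F → IsMonopole (.allLab F)
  | allFml {l f} {F : LL σ l (f + 1)} : IsMonopole F → IsMonopole (.allFml F)
  | quest {l f} (a : Atom σ l f) : IsMonopole (.quest (.atom a))

/-- Formulae built from monopoles and negated atoms with the positive connectives, where `!` is
applied to monopoles only. -/
inductive IsBipolar {σ : Signature} : ∀ {l f : ℕ}, LL σ l f → Prop
  | mono {l f} {F : LL σ l f} : IsMonopole F → IsBipolar F
  | natom {l f} (a : Atom σ l f) : IsBipolar (.natom a)
  | one {l f} : IsBipolar (.one : LL σ l f)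
  | zero {l f} : IsBipolar (.zero : LL σ l f)
  | tensor {l f} {F G : LL σ l f} : IsBipolar F → IsBipolar G → IsBipolar (.tensor F G)
  | plus {l f} {F G : LL σ l f} : IsBipolar F → IsBipolar G → IsBipolar (.plus F G)
  | exLab {l f} {F : LL σ (l + 1) f} : IsBipolar F → IsBipolar (.exLab F)
  | exFml {l f} {F : LL σ l (f + 1)} : IsBipolar F → IsBipolar (.exFml F)
  | bang {l f} {F : LL σ l f} : IsMonopole F → IsBipolar (.bang F)

/-- Bipoles. -/
def IsBipole {σ : Signature} {l f : ℕ} (F : LL σ l f) : Prop := F.IsPositive ∧ IsBipolar F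

/-! ### Specifications of labelled line sequent systems -/

/-- The multiset `⌊left⌋, ⌈right⌉`. -/
def LSeq.encFml {σ : Signature} (S : LSeq σ) : Multiset (LL σ 0 0) :=
  S.left.map (fun a => .atom (.lft (.name a.1) a.2)) +
    S.right.map (fun a => .atom (.rght (.name a.1) a.2))

/-- The meta-level atom for the relation term. -/
def LSeq.encRel {σ : Signature} (S : LSeq σ) : LL σ 0 0 :=
  .atom (.rel S.rel fun i => .name (S.args i))

/-- The linear context that encodes a sequent, all of its atoms being stored. -/
def LSeq.enc {σ : Signature} (S : LSeq σ) : Multiset (LL σ 0 0) := S.encRel ::ₘ S.encFml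

/-- The LLF judgement `⊢ Θ; ℛ ⇑ ⌊Γ⌋, ⌈Δ⌉` for the sequent `ℛ, Γ ⇒ Δ` (the order in which the
atoms are listed is immaterial). -/
noncomputable def LSeq.judgement {σ : Signature} (Θ : Set (LL σ 0 0)) (S : LSeq σ) :
    Judgement σ :=
  .up Θ {S.encRel} S.encFml.toList

/-- A set of border sequents `⊢ Θ; Γ ⇑ ·`, given by the pairs `(Θ, Γ)`, that is closed under
bijective renamings of the state variables. -/
def RenamingClosed {σ : Signature} (H : Set (Set (LL σ 0 0) × Multiset (LL σ 0 0))) : Prop :=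
  ∀ (g : Equiv.Perm ℕ) (b), b ∈ H → (LL.rename g '' b.1, b.2.map (LL.rename g)) ∈ H

/-- In the theory `Θ`, focusing on the clause `C` corresponds exactly to applying the rule `r`:
for every sequent `S` and every set `H` of open leaves (up to the choice of the names of state
variables), `S` is the conclusion of an instance of `r` whose premisses have their encodings in
`H` iff the encoding of `S`, with focus on `C`, has a derivation consisting of a single positive
phase and a single negative phase with open leaves in `H`. As `H` may hold any border sequents,
this includes that the leaves produced by the two phases are encodings of object-level
sequents. -/
def AdequateClause {σ : Signature} (Θ : Set (LL σ 0 0)) (r : LLSRule σ) (C : LL σ 0 0) : Prop :=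
  ∀ H : Set (Set (LL σ 0 0) × Multiset (LL σ 0 0)), RenamingClosed H → ∀ S : LSeq σ,
    (∃ ps, r.Inst ps S ∧ ∀ p ∈ ps, (Θ, p.enc) ∈ H) ↔
      Derivable PhaseRule {j | ∃ b ∈ H, j = .up b.1 b.2 []} (.down Θ S.enc C)

/-- `spec` assigns to every rule of `L₀` a bipole clause without free state variables, and is an
adequate specification of the rules of `L₀`. -/
def IsAdequateSpec {σ : Signature} (L₀ : Set (LLSRule σ)) (spec : LLSRule σ → LL σ 0 0) : Prop :=
  ∀ r ∈ L₀, IsBipole (spec r) ∧ (∀ y, (spec r).FreshLab y) ∧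
    AdequateClause (spec '' L₀) r (spec r)

end LLSpec

namespace LLSpec

/-! ### Substitution -/

/-! The heart of the matter is a canonical clause for each rule: existential quantifiers over its
labels and formula metavariables, a tensor of the negated atoms of its conclusion, and then a
monopole that quantifies universally over the fresh labels and joins by & the premisses, each
written as a ⅋ of its atoms. Focusing on it leaves no freedom beyond the choice of an instance. The
witnesses fix labels and formulae; since the theory contains no atoms, each negated atom must
consume its dual from the linear context, so what is left is the encoding of a side context; the
negative phase copies this to every premiss. This is `LLSRule.adequateClause`.

For an arbitrary adequate specification, object proofs and LLF proofs are matched one rule at a time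
(`IsAdequateSpec.llfProvable_iff`). A rule instance becomes a decision on its clause followed by the
two phases. Conversely, an LLF proof is cut at its decision rules: an encoding consists of atoms,
which cannot be focused on, so a decision must pick a clause, and adequacy turns the phases above it
into a rule instance. The statement for infinite systems follows because a proof uses finitely many
rules (`Provable.exists_finite`).

The delicate point is the eigenvariables. The rule for ∀ asks for freshness in the current judgement
only, whereas fresh labels of an instance must avoid the whole conclusion, including atoms already
consumed, and each other. Derivability is invariant under permutations of state variables when the
set of leaves is, so an unsuitable eigenvariable can be swapped for a suitable one. -/

theorem Fml.subst_subst {M : Type} {n k m : ℕ} (t : Fin n → Fml M k) (t' : Fin k → Fml M m)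
    (A : Fml M n) : (A.subst t).subst t' = A.subst fun i => (t i).subst t' := by
  induction A <;> simp_all [Fml.subst]

theorem Fml.subst_var {M : Type} {n : ℕ} (A : Fml M n) : A.subst Fml.var = A := by
  induction A <;> simp_all [Fml.subst]

theorem Fml.Fresh.subst {M : Type} {n k p : ℕ} {t : Fin n → Fml M k} (ht : ∀ i, (t i).Fresh p)
    {A : Fml M n} (hA : A.Fresh p) : (A.subst t).Fresh p := by
  induction A <;> simp_all [Fml.subst, Fml.Fresh]

theorem liftLab_bvar {l : ℕ} : liftLab (LTm.bvar : Fin l → LTm l) = LTm.bvar := by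
  funext i
  refine Fin.cases ?_ (fun j => ?_) i <;> simp [liftLab, LTm.subst]

theorem liftFml_var {M : Type} {f : ℕ} :
    liftFml (Fml.var : Fin f → Fml M f) = Fml.var := by
  funext i
  refine Fin.cases ?_ (fun j => ?_) i <;> simp [liftFml, Fml.subst]

theorem LTm.subst_subst {l l' l'' : ℕ} (g g' : ℕ → ℕ) (s : Fin l → LTm l') (s' : Fin l' → LTm l'')
    (x : LTm l) :
    (x.subst g s).subst g' s' = x.subst (g' ∘ g) fun i => (s i).subst g' s' := by
  cases x <;> rfl

theorem LTm.subst_id {l : ℕ} (x : LTm l) : x.subst id LTm.bvar = x := by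
  cases x <;> rfl

/-- Weakening fixes the state variables, so it commutes with the renaming `g'`. This is the binder
case of the composition law for substitutions. -/
theorem liftLab_subst {l l' l'' : ℕ} (g' : ℕ → ℕ) (s : Fin l → LTm l') (s' : Fin l' → LTm l'') :
    (fun i => (liftLab s i).subst g' (liftLab s')) = liftLab fun i => (s i).subst g' s' := by
  funext i
  refine Fin.cases ?_ (fun j => ?_) i
  · simp [liftLab, LTm.subst]
  · simp only [liftLab, Fin.cons_succ, LTm.subst_subst]
    rfl

theorem liftFml_subst {M : Type} {f f' f'' : ℕ} (t : Fin f → Fml M f') (t' : Fin f' → Fml M f'') :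
    (fun i => (liftFml t i).subst (liftFml t')) = liftFml fun i => (t i).subst t' := by
  funext i
  refine Fin.cases ?_ (fun j => ?_) i
  · simp [liftFml, Fml.subst]
  · simp [liftFml, Fml.subst_subst, Fml.subst]

variable {σ : Signature}

theorem Atom.subst_subst {l l' l'' f f' f'' : ℕ} (g g' : ℕ → ℕ) (s : Fin l → LTm l')
    (s' : Fin l' → LTm l'') (t : Fin f → Fml σ.Mod f') (t' : Fin f' → Fml σ.Mod f'')
    (a : Atom σ l f) :
    (a.subst g s t).subst g' s' t' =
      a.subst (g' ∘ g) (fun i => (s i).subst g' s') fun i => (t i).subst t' := by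
  cases a <;> simp [Atom.subst, LTm.subst_subst, Fml.subst_subst]

theorem LL.subst_subst {l f : ℕ} (F : LL σ l f) : ∀ {l' l'' f' f'' : ℕ} (g g' : ℕ → ℕ)
    (s : Fin l → LTm l') (s' : Fin l' → LTm l'') (t : Fin f → Fml σ.Mod f')
    (t' : Fin f' → Fml σ.Mod f''),
    (F.subst g s t).subst g' s' t' =
      F.subst (g' ∘ g) (fun i => (s i).subst g' s') fun i => (t i).subst t' := by
  induction F <;> intros <;>
    simp_all [LL.subst, Atom.subst_subst, liftLab_subst, liftFml_subst]

theorem Atom.subst_id {l f : ℕ} (a : Atom σ l f) : a.subst id LTm.bvar Fml.var = a := by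
  cases a <;> simp [Atom.subst, LTm.subst_id, Fml.subst_var]

theorem LL.subst_id {l f : ℕ} (F : LL σ l f) : F.subst id LTm.bvar Fml.var = F := by
  induction F <;> simp_all [LL.subst, Atom.subst_id, liftLab_bvar, liftFml_var]

/-- Two names `y`, `y'` serve two uses: `y' = y` when the state variables are left alone, and `y' =
g y` for a permutation `g`. -/
theorem LTm.FreshLab.subst {l l' y y' : ℕ} {g : ℕ → ℕ} (hg : ∀ x, y ≠ x → y' ≠ g x)
    {s : Fin l → LTm l'} (hs : ∀ i, (s i).FreshLab y') {x : LTm l} (hx : x.FreshLab y) :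
    (x.subst g s).FreshLab y' := by
  cases x
  · exact hg _ hx
  · exact hs _

theorem freshLab_liftLab {l l' y : ℕ} {s : Fin l → LTm l'} (hs : ∀ i, (s i).FreshLab y)
    (i : Fin (l + 1)) : (liftLab s i).FreshLab y := by
  refine Fin.cases ?_ (fun j => ?_) i
  · trivial
  · exact (hs j).subst (y := y) (fun _ h => h) fun _ => by exact trivial

theorem fresh_liftFml {M : Type} {f f' p : ℕ} {t : Fin f → Fml M f'} (ht : ∀ i, (t i).Fresh p)
    (i : Fin (f + 1)) : (liftFml t i).Fresh p := by
  refine Fin.cases ?_ (fun j => ?_) i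
  · trivial
  · exact Fml.Fresh.subst (fun _ => by exact trivial) (ht j)

theorem Atom.FreshLab.subst {l l' f f' y y' : ℕ} {g : ℕ → ℕ} (hg : ∀ x, y ≠ x → y' ≠ g x)
    {s : Fin l → LTm l'} (hs : ∀ i, (s i).FreshLab y') (t : Fin f → Fml σ.Mod f')
    {a : Atom σ l f} (ha : a.FreshLab y) : (a.subst g s t).FreshLab y' := by
  cases a
  · exact LTm.FreshLab.subst hg hs ha
  · exact LTm.FreshLab.subst hg hs ha
  · exact fun i => LTm.FreshLab.subst hg hs (ha i)

theorem Atom.FreshProp.subst {l l' f f' p : ℕ} (g : ℕ → ℕ) (s : Fin l → LTm l')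
    {t : Fin f → Fml σ.Mod f'} (ht : ∀ i, (t i).Fresh p)
    {a : Atom σ l f} (ha : a.FreshProp p) : (a.subst g s t).FreshProp p := by
  cases a
  · exact Fml.Fresh.subst ht ha
  · exact Fml.Fresh.subst ht ha
  · trivial

theorem LL.FreshLab.subst {l f : ℕ} {F : LL σ l f} : ∀ {l' f' y y' : ℕ} {g : ℕ → ℕ}
    (_ : ∀ x, y ≠ x → y' ≠ g x) {s : Fin l → LTm l'} (_ : ∀ i, (s i).FreshLab y')
    (t : Fin f → Fml σ.Mod f') (_ : F.FreshLab y), (F.subst g s t).FreshLab y' := by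
  unfold LL.FreshLab
  induction F <;> intro l' f' y y' g hg s hs t hF <;> simp only [LL.subst, LL.AllAtoms] at hF ⊢
  case atom => exact Atom.FreshLab.subst hg hs t hF
  case natom => exact Atom.FreshLab.subst hg hs t hF
  case tensor ih₁ ih₂ => exact ⟨ih₁ hg hs t hF.1, ih₂ hg hs t hF.2⟩
  case par ih₁ ih₂ => exact ⟨ih₁ hg hs t hF.1, ih₂ hg hs t hF.2⟩
  case wth ih₁ ih₂ => exact ⟨ih₁ hg hs t hF.1, ih₂ hg hs t hF.2⟩
  case plus ih₁ ih₂ => exact ⟨ih₁ hg hs t hF.1, ih₂ hg hs t hF.2⟩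
  case exLab ih => exact ih hg (freshLab_liftLab hs) t hF
  case allLab ih => exact ih hg (freshLab_liftLab hs) t hF
  case exFml ih => exact ih hg hs _ hF
  case allFml ih => exact ih hg hs _ hF
  case quest ih => exact ih hg hs _ hF
  case bang ih => exact ih hg hs _ hF

theorem LL.FreshProp.subst {l f : ℕ} {F : LL σ l f} : ∀ {l' f' p : ℕ} (g : ℕ → ℕ)
    (s : Fin l → LTm l') {t : Fin f → Fml σ.Mod f'} (_ : ∀ i, (t i).Fresh p)
    (_ : F.FreshProp p), (F.subst g s t).FreshProp p := by
  unfold LL.FreshProp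
  induction F <;> intro l' f' p g s t ht hF <;> simp only [LL.subst, LL.AllAtoms] at hF ⊢
  case atom => exact Atom.FreshProp.subst g s ht hF
  case natom => exact Atom.FreshProp.subst g s ht hF
  case tensor ih₁ ih₂ => exact ⟨ih₁ g s ht hF.1, ih₂ g s ht hF.2⟩
  case par ih₁ ih₂ => exact ⟨ih₁ g s ht hF.1, ih₂ g s ht hF.2⟩
  case wth ih₁ ih₂ => exact ⟨ih₁ g s ht hF.1, ih₂ g s ht hF.2⟩
  case plus ih₁ ih₂ => exact ⟨ih₁ g s ht hF.1, ih₂ g s ht hF.2⟩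
  case exLab ih => exact ih g _ ht hF
  case allLab ih => exact ih g _ ht hF
  case exFml ih => exact ih g _ (fresh_liftFml ht) hF
  case allFml ih => exact ih g _ (fresh_liftFml ht) hF
  case quest ih => exact ih g s ht hF
  case bang ih => exact ih g s ht hF

theorem LTm.subst_congr {l l' : ℕ} {g g' : ℕ → ℕ} {s : Fin l → LTm l'} {x : LTm l}
    (h : ∀ y, g y = g' y ∨ x.FreshLab y) : x.subst g s = x.subst g' s := by
  cases x with
  | name x => exact congrArg LTm.name ((h x).resolve_right fun h => h rfl)
  | bvar i => rfl

theorem Atom.subst_congr {l l' f f' : ℕ} {g g' : ℕ → ℕ} {s : Fin l → LTm l'}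
    {t : Fin f → Fml σ.Mod f'} {a : Atom σ l f} (h : ∀ y, g y = g' y ∨ a.FreshLab y) :
    a.subst g s t = a.subst g' s t := by
  cases a with
  | lft x A => simp only [Atom.subst, LTm.subst_congr (s := s) (x := x) h]
  | rght x A => simp only [Atom.subst, LTm.subst_congr (s := s) (x := x) h]
  | rel r args =>
    simp only [Atom.subst]
    congr 1
    funext i
    exact LTm.subst_congr fun y => (h y).imp_right fun h => h i

/-- Only the values of a renaming at the state variables that occur in the formula matter. -/
theorem LL.subst_congr {l f : ℕ} {F : LL σ l f} : ∀ {l' f' : ℕ} {g g' : ℕ → ℕ}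
    {s : Fin l → LTm l'} {t : Fin f → Fml σ.Mod f'} (_ : ∀ y, g y = g' y ∨ F.FreshLab y),
    F.subst g s t = F.subst g' s t := by
  unfold LL.FreshLab
  induction F <;> intro l' f' g g' s t h <;> simp only [LL.subst, LL.AllAtoms] at h ⊢
  case atom => exact congrArg _ (Atom.subst_congr h)
  case natom => exact congrArg _ (Atom.subst_congr h)
  case tensor ih₁ ih₂ =>
    rw [ih₁ fun y => (h y).imp_right And.left, ih₂ fun y => (h y).imp_right And.right]
  case par ih₁ ih₂ =>
    rw [ih₁ fun y => (h y).imp_right And.left, ih₂ fun y => (h y).imp_right And.right]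
  case wth ih₁ ih₂ =>
    rw [ih₁ fun y => (h y).imp_right And.left, ih₂ fun y => (h y).imp_right And.right]
  case plus ih₁ ih₂ =>
    rw [ih₁ fun y => (h y).imp_right And.left, ih₂ fun y => (h y).imp_right And.right]
  case exLab ih => rw [ih h]
  case allLab ih => rw [ih h]
  case exFml ih => rw [ih h]
  case allFml ih => rw [ih h]
  case quest ih => rw [ih h]
  case bang ih => rw [ih h]

/-! ### Renamings of closed formulae -/

theorem LL.rename_rename (g g' : ℕ → ℕ) (F : LL σ 0 0) :
    (F.rename g).rename g' = F.rename (g' ∘ g) := by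
  simp [LL.rename, LL.subst_subst, LTm.subst, Fml.subst]

theorem LL.rename_id (F : LL σ 0 0) : F.rename id = F := LL.subst_id F

theorem LL.rename_eq_self {g : ℕ → ℕ} {F : LL σ 0 0} (h : ∀ y, g y = y ∨ F.FreshLab y) :
    F.rename g = F :=
  (LL.subst_congr h).trans F.rename_id

theorem LL.rename_swap {y y' : ℕ} {F : LL σ 0 0} (h : F.FreshLab y) (h' : F.FreshLab y') :
    F.rename (Equiv.swap y y') = F := by
  refine LL.rename_eq_self fun x => ?_
  by_cases hx : x = y
  · exact .inr (hx ▸ h)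
  by_cases hx' : x = y'
  · exact .inr (hx' ▸ h')
  exact .inl (Equiv.swap_apply_of_ne_of_ne hx hx')

theorem LL.rename_instLab (g : ℕ → ℕ) (F : LL σ 1 0) (x : ℕ) :
    (F.instLab x).rename g = (F.subst g LTm.bvar Fml.var).instLab (g x) := by
  simp [LL.rename, LL.instLab, LL.subst_subst, LTm.subst, Fml.subst]

theorem LL.rename_instFml (g : ℕ → ℕ) (F : LL σ 0 1) (A : Fml σ.Mod 0) :
    (F.instFml A).rename g = (F.subst g LTm.bvar Fml.var).instFml A := by
  simp [LL.rename, LL.instFml, LL.subst_subst, LTm.subst, Fml.subst, Fml.subst_var]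

theorem LL.isAtom_subst {l l' f f' : ℕ} {g : ℕ → ℕ} {s : Fin l → LTm l'}
    {t : Fin f → Fml σ.Mod f'} {F : LL σ l f} : (F.subst g s t).IsAtom ↔ F.IsAtom := by
  cases F <;> rfl

theorem LL.isNegative_subst {l l' f f' : ℕ} {g : ℕ → ℕ} {s : Fin l → LTm l'}
    {t : Fin f → Fml σ.Mod f'} {F : LL σ l f} : (F.subst g s t).IsNegative ↔ F.IsNegative := by
  cases F <;> rfl

/-! ### Invariance of derivability under renamings of the state variables -/

theorem Derivable.map {α : Type*} {R : List α → α → Prop} {H : Set α} {φ : α → α}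
    (hR : ∀ ps a, R ps a → R (ps.map φ) (φ a)) (hH : ∀ a ∈ H, φ a ∈ H) {a : α}
    (h : Derivable R H a) : Derivable R H (φ a) := by
  induction h with
  | hyp h => exact .hyp (hH _ h)
  | rule h _ ih =>
    refine .rule (hR _ _ h) fun p hp => ?_
    obtain ⟨q, hq, rfl⟩ := List.mem_map.1 hp
    exact ih q hq

/-- Renaming of the state variables of a judgement. -/
def Judgement.rename (g : ℕ → ℕ) : Judgement σ → Judgement σ
  | .up Θ Γ L => .up (LL.rename g '' Θ) (Γ.map (LL.rename g)) (L.map (LL.rename g))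
  | .down Θ Γ F => .down (LL.rename g '' Θ) (Γ.map (LL.rename g)) (F.rename g)

theorem LL.FreshLab.subst_perm {l f y : ℕ} {F : LL σ l f} (g : Equiv.Perm ℕ) (h : F.FreshLab y) :
    (F.subst g LTm.bvar Fml.var).FreshLab (g y) :=
  h.subst (fun _ hx => g.injective.ne hx) (fun _ => by exact trivial) _

theorem LL.FreshProp.subst_rename {l f p : ℕ} {F : LL σ l f} (g : ℕ → ℕ) (h : F.FreshProp p) :
    (F.subst g LTm.bvar Fml.var).FreshProp p :=
  h.subst _ _ fun _ => by exact trivial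

/-- Only the rule for ∀ over labels needs `g` to be injective: its eigenvariable `y` becomes `g y`,
which must stay fresh. Propositional eigenvariables are untouched, as renamings act on labels alone.
-/
theorem PhaseRule.rename (g : Equiv.Perm ℕ) {ps : List (Judgement σ)} {j : Judgement σ}
    (h : PhaseRule ps j) : PhaseRule (ps.map (Judgement.rename g)) (j.rename g) := by
  cases h with
  | top => exact .top
  | bot => exact .bot
  | par => exact .par
  | wth => exact .wth
  | quest =>
    simp only [List.map, Judgement.rename, Set.image_insert_eq]
    exact .quest
  | @allLab Θ Γ L F y hΘ hΓ hL hF =>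
    have hset : ∀ G : LL σ 0 0, G.FreshLab y → (G.rename g).FreshLab (g y) :=
      fun G hG => hG.subst_perm g
    simp only [List.map, Judgement.rename, LL.rename_instLab]
    rw [show LL.rename g (.allLab F) = .allLab (F.subst g LTm.bvar Fml.var) by
      simp [LL.rename, LL.subst, liftLab_bvar]]
    refine .allLab (g y) ?_ ?_ ?_ (hF.subst_perm g)
    · rintro _ ⟨G, hG, rfl⟩
      exact hset G (hΘ G hG)
    · intro _ hG'
      obtain ⟨G, hG, rfl⟩ := Multiset.mem_map.1 hG'
      exact hset G (hΓ G hG)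
    · intro _ hG'
      obtain ⟨G, hG, rfl⟩ := List.mem_map.1 hG'
      exact hset G (hL G hG)
  | @allFml Θ Γ L F p hΘ hΓ hL hF =>
    have hset : ∀ G : LL σ 0 0, G.FreshProp p → (G.rename g).FreshProp p :=
      fun G hG => hG.subst_rename g
    simp only [List.map, Judgement.rename, LL.rename_instFml]
    rw [show LL.rename g (.allFml F) = .allFml (F.subst g LTm.bvar Fml.var) by
      simp [LL.rename, LL.subst, liftFml_var]]
    refine .allFml p ?_ ?_ ?_ (hF.subst_rename g)
    · rintro _ ⟨G, hG, rfl⟩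
      exact hset G (hΘ G hG)
    · intro _ hG'
      obtain ⟨G, hG, rfl⟩ := Multiset.mem_map.1 hG'
      exact hset G (hΓ G hG)
    · intro _ hG'
      obtain ⟨G, hG, rfl⟩ := List.mem_map.1 hG'
      exact hset G (hL G hG)
  | store hF =>
    simp only [List.map, Judgement.rename, Multiset.map_cons]
    exact .store (hF.imp (fun h => mt LL.isNegative_subst.1 h) LL.isAtom_subst.2)
  | one => exact .one
  | tensor =>
    simp only [List.map, Judgement.rename, Multiset.map_add]
    exact .tensor
  | plusLeft => exact .plusLeft
  | plusRight => exact .plusRight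
  | @exLab Θ Γ F x =>
    simp only [List.map, Judgement.rename, LL.rename_instLab]
    rw [show LL.rename g (.exLab F) = .exLab (F.subst g LTm.bvar Fml.var) by
      simp [LL.rename, LL.subst, liftLab_bvar]]
    exact .exLab (g x)
  | @exFml Θ Γ F A =>
    simp only [List.map, Judgement.rename, LL.rename_instFml]
    rw [show LL.rename g (.exFml F) = .exFml (F.subst g LTm.bvar Fml.var) by
      simp [LL.rename, LL.subst, liftFml_var]]
    exact .exFml A
  | bang => exact .bang
  | release hF => exact .release (LL.isNegative_subst.2 hF)
  | init₁ => exact .init₁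
  | init₂ ha => exact .init₂ (Set.mem_image_of_mem _ ha)

theorem LLFRule.rename (g : Equiv.Perm ℕ) {ps : List (Judgement σ)} {j : Judgement σ}
    (h : LLFRule ps j) : LLFRule (ps.map (Judgement.rename g)) (j.rename g) := by
  cases h with
  | phase h => exact .phase (h.rename g)
  | decide₁ hF =>
    simp only [Judgement.rename, Multiset.map_cons]
    exact .decide₁ (mt LL.isAtom_subst.1 hF)
  | decide₂ hΘ hF => exact .decide₂ (Set.mem_image_of_mem _ hΘ) (mt LL.isAtom_subst.1 hF)

theorem LLFProvable.rename (g : Equiv.Perm ℕ) {j : Judgement σ} (h : LLFProvable j) :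
    LLFProvable (j.rename g) :=
  Derivable.map (fun _ _ h => h.rename g) (fun _ h => h.elim) h

/-- The judgements that are open leaves of a pair of phases, for a set of border sequents. -/
def leaves (H : Set (Set (LL σ 0 0) × Multiset (LL σ 0 0))) : Set (Judgement σ) :=
  {j | ∃ b ∈ H, j = .up b.1 b.2 []}

theorem derivable_phaseRule_rename {H : Set (Set (LL σ 0 0) × Multiset (LL σ 0 0))}
    (hH : RenamingClosed H) (g : Equiv.Perm ℕ) {j : Judgement σ}
    (h : Derivable PhaseRule (leaves H) j) : Derivable PhaseRule (leaves H) (j.rename g) := by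
  refine Derivable.map (fun _ _ h => h.rename g) ?_ h
  rintro _ ⟨b, hb, rfl⟩
  exact ⟨_, hH g b hb, rfl⟩

/-! ### Soundness and completeness of adequate specifications -/

/-- Derivations of the open leaves are grafted onto the tree; this glues a pair of phases to the LLF
proofs above it. -/
theorem Derivable.trans {α : Type*} {R R' : List α → α → Prop} {H H' : Set α}
    (hR : ∀ ps a, R ps a → R' ps a) (hH : ∀ a ∈ H, Derivable R' H' a) {a : α}
    (h : Derivable R H a) : Derivable R' H' a := by
  induction h with
  | hyp h => exact hH _ h
  | rule h _ ih => exact .rule (hR _ _ h) ih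

theorem Provable.mono {L L' : Set (LLSRule σ)} (h : L ⊆ L') {S : LSeq σ} (hS : Provable L S) :
    Provable L' S :=
  Derivable.trans (fun _ _ ⟨r, hr, hi⟩ => ⟨r, h hr, hi⟩) (fun _ h => h.elim) hS

/-- A proof uses finitely many rules. -/
theorem Provable.exists_finite {L : Set (LLSRule σ)} {S : LSeq σ} (h : Provable L S) :
    ∃ L₀ ⊆ L, L₀.Finite ∧ Provable L₀ S := by
  unfold Provable at h
  induction h with
  | hyp h => exact h.elim
  | @rule ps a h _ ih =>
    obtain ⟨r, hr, hi⟩ := h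
    -- `K p` is a finite set of rules that suffices for the premiss `p`; there are finitely many
    -- premisses.
    choose! K hK using ih
    refine ⟨insert r (⋃ p ∈ {p | p ∈ ps}, K p), ?_, ?_, ?_⟩
    · exact Set.insert_subset hr (Set.iUnion₂_subset fun p hp => (hK p hp).1)
    · exact ((List.finite_toSet ps).biUnion fun p hp => (hK p hp).2.1).insert r
    · refine .rule ⟨r, Set.mem_insert _ _, hi⟩ fun p hp => ?_
      have hsub : K p ⊆ insert r (⋃ p ∈ {p | p ∈ ps}, K p) := fun x hx =>
        Set.mem_insert_of_mem _ (Set.mem_biUnion (s := {p | p ∈ ps}) hp hx)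
      exact Provable.mono hsub (hK p hp).2.2

theorem LL.IsAtom.of_mem_enc {S : LSeq σ} {F : LL σ 0 0} (h : F ∈ S.enc) : F.IsAtom := by
  simp only [LSeq.enc, LSeq.encFml, LSeq.encRel, Multiset.mem_cons, Multiset.mem_add,
    Multiset.mem_map] at h
  rcases h with rfl | ⟨_, _, rfl⟩ | ⟨_, _, rfl⟩ <;> trivial

/-- With an atom at the head of the list, storing it is the only applicable rule, so storing is
invertible. -/
theorem llfProvable_store_iff {Θ : Set (LL σ 0 0)} {L : List (LL σ 0 0)} :
    ∀ {Γ : Multiset (LL σ 0 0)} (_ : ∀ F ∈ L, F.IsAtom),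
      LLFProvable (.up Θ Γ L) ↔ LLFProvable (.up Θ (L + Γ) []) := by
  induction L with
  | nil => intro Γ _; simp
  | cons F L ih =>
    intro Γ hL
    have hF := hL F (by simp)
    have e : ((F :: L : List _) : Multiset (LL σ 0 0)) + Γ = L + F ::ₘ Γ := by
      rw [← Multiset.cons_coe, Multiset.cons_add, Multiset.add_cons]
    rw [e, ← ih fun G hG => hL G (by simp [hG])]
    constructor
    · intro h
      cases F with
      | atom a =>
        cases h with
        | hyp h => exact h.elim
        | rule h hp =>
          cases h with
          | phase h =>
            cases h with
            | store => exact hp _ (by simp)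
      | _ => exact hF.elim
    · intro h
      refine .rule (.phase (.store (.inr hF))) fun j hj => ?_
      rw [List.mem_singleton.1 hj]
      exact h

theorem llfProvable_judgement_iff {Θ : Set (LL σ 0 0)} {S : LSeq σ} :
    LLFProvable (S.judgement Θ) ↔ LLFProvable (.up Θ S.enc []) := by
  unfold LSeq.judgement
  rw [llfProvable_store_iff, Multiset.coe_toList, LSeq.enc, add_comm, Multiset.singleton_add]
  intro F hF
  exact LL.IsAtom.of_mem_enc (Multiset.mem_cons_of_mem (Multiset.mem_toList.1 hF))

theorem LL.IsPositive.not_isAtom {l f : ℕ} {F : LL σ l f} (h : F.IsPositive) : ¬ F.IsAtom := by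
  cases F with
  | atom a => exact absurd trivial h
  | _ => exact id

theorem IsAdequateSpec.image_rename {L₀ : Set (LLSRule σ)} {spec : LLSRule σ → LL σ 0 0}
    (h : IsAdequateSpec L₀ spec) (g : ℕ → ℕ) : LL.rename g '' (spec '' L₀) = spec '' L₀ := by
  rw [Set.image_image]
  exact Set.image_congr fun r hr => LL.rename_eq_self fun y => .inr ((h r hr).2.1 y)

/-- Induction on the object-level proof, using adequacy with the LLF-provable border sequents as
leaves. These are closed under renamings because LLF provability is. -/
theorem IsAdequateSpec.llfProvable {L₀ : Set (LLSRule σ)} {spec : LLSRule σ → LL σ 0 0}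
    (h : IsAdequateSpec L₀ spec) {S : LSeq σ} (hS : Provable L₀ S) :
    LLFProvable (.up (spec '' L₀) S.enc []) := by
  unfold Provable at hS
  induction hS with
  | hyp h => exact h.elim
  | @rule ps S hr _ ih =>
    obtain ⟨r, hr, hi⟩ := hr
    obtain ⟨hb, -, ha⟩ := h r hr
    refine .rule (.decide₂ (Set.mem_image_of_mem _ hr) hb.1.not_isAtom) fun j hj => ?_
    rw [List.mem_singleton.1 hj]
    have key := (ha {b | LLFProvable (.up b.1 b.2 [])} (fun g b hb => hb.rename g) S).1
      ⟨ps, hi, ih⟩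
    refine Derivable.trans (fun _ _ => .phase) ?_ key
    rintro _ ⟨b, hb, rfl⟩
    exact hb

/-- The border sequents which, if they encode a sequent up to a renaming, encode one that is
provable. -/
def provableBorder (L₀ : Set (LLSRule σ)) (Θ : Set (LL σ 0 0)) :
    Set (Set (LL σ 0 0) × Multiset (LL σ 0 0)) :=
  {b | ∀ (g : Equiv.Perm ℕ) (S : LSeq σ), LL.rename g '' b.1 = Θ →
    b.2.map (LL.rename g) = S.enc → Provable L₀ S}

theorem renamingClosed_provableBorder (L₀ : Set (LLSRule σ)) (Θ : Set (LL σ 0 0)) :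
    RenamingClosed (provableBorder L₀ Θ) := by
  intro g b hb g' S hΘ hS
  refine hb (g.trans g') S ?_ ?_
  · rw [← hΘ, Set.image_image]
    exact Set.image_congr fun F _ => (LL.rename_rename g g' F).symm
  · rw [← hS, Multiset.map_map]
    exact Multiset.map_congr rfl fun F _ => (LL.rename_rename g g' F).symm

/-- The LLF proof is cut at its lowest decision rules. The induction covers judgements of every
shape, with `provableBorder` as invariant at the cuts; it quantifies over renamings because adequacy
accepts only renaming-closed sets of leaves. -/
theorem IsAdequateSpec.derivable_phaseRule {L₀ : Set (LLSRule σ)} {spec : LLSRule σ → LL σ 0 0}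
    (h : IsAdequateSpec L₀ spec) {j : Judgement σ} (hj : LLFProvable j) :
    Derivable PhaseRule (leaves (provableBorder L₀ (spec '' L₀))) j := by
  unfold LLFProvable at hj
  induction hj with
  | hyp h => exact h.elim
  | rule hr _ ih =>
    cases hr with
    | phase hr => exact .rule hr ih
    | @decide₁ Θ Γ F hF =>
      -- The condition holds vacuously: a linear context containing the non-atom `F` encodes no
      -- sequent under any renaming.
      refine .hyp ⟨(Θ, F ::ₘ Γ), fun g S _ hS => ?_, rfl⟩
      have : (F.rename g).IsAtom := by
        refine LL.IsAtom.of_mem_enc (S := S) ?_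
        rw [← hS]
        exact Multiset.mem_map_of_mem _ (Multiset.mem_cons_self _ _)
      exact absurd (LL.isAtom_subst.1 this) hF
    | @decide₂ Θ Γ F hΘ hF =>
      refine .hyp ⟨(Θ, Γ), fun g S hg hS => ?_, rfl⟩
      -- Renaming the focused premiss by `g` gives a focus on a clause with linear context exactly
      -- `S.enc`, to which adequacy applies.
      have hd := derivable_phaseRule_rename (renamingClosed_provableBorder _ _) g
        (ih _ (List.mem_singleton_self _))
      simp only [Judgement.rename] at hd hg hS
      obtain ⟨r, hr, hrF⟩ : F.rename g ∈ spec '' L₀ := hg ▸ Set.mem_image_of_mem _ hΘ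
      rw [hg, hS, ← hrF] at hd
      obtain ⟨ps, hi, hps⟩ := ((h r hr).2.2 _ (renamingClosed_provableBorder _ _) S).2 hd
      refine .rule ⟨r, hr, hi⟩ fun p hp => ?_
      refine hps p hp (Equiv.refl ℕ) p (h.image_rename _) ?_
      exact (Multiset.map_congr rfl fun F _ => F.rename_id).trans (Multiset.map_id _)

theorem not_phaseRule_nil {ps : List (Judgement σ)} {Θ : Set (LL σ 0 0)}
    {Γ : Multiset (LL σ 0 0)} : ¬ PhaseRule ps (.up Θ Γ []) := by
  intro h
  cases h

theorem derivable_up_nil_iff {H : Set (Set (LL σ 0 0) × Multiset (LL σ 0 0))}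
    {Θ : Set (LL σ 0 0)} {Γ : Multiset (LL σ 0 0)} :
    Derivable PhaseRule (leaves H) (.up Θ Γ []) ↔ (Θ, Γ) ∈ H := by
  constructor
  · intro h
    cases h with
    | hyp h =>
      obtain ⟨b, hb, he⟩ := h
      cases he
      exact hb
    | rule h _ => exact (not_phaseRule_nil h).elim
  · exact fun h => .hyp ⟨_, h, rfl⟩

/-- No phase rule ends in a border sequent, so its phase derivation is a bare leaf; the invariant is
then read at the identity renaming. -/
theorem IsAdequateSpec.llfProvable_iff {L₀ : Set (LLSRule σ)} {spec : LLSRule σ → LL σ 0 0}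
    (h : IsAdequateSpec L₀ spec) {S : LSeq σ} :
    LLFProvable (S.judgement (spec '' L₀)) ↔ Provable L₀ S := by
  rw [llfProvable_judgement_iff]
  refine ⟨fun hS => ?_, h.llfProvable⟩
  exact derivable_up_nil_iff.1 (h.derivable_phaseRule hS) (Equiv.refl ℕ) S (h.image_rename _)
    ((Multiset.map_congr rfl fun F _ => F.rename_id).trans (Multiset.map_id _))

/-! ### The clause of a rule -/

def LL.exLabs {f : ℕ} : (k : ℕ) → LL σ k f → LL σ 0 f
  | 0, F => F
  | k + 1, F => exLabs k (.exLab F)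

def LL.exFmls {l : ℕ} : (n : ℕ) → LL σ l n → LL σ l 0
  | 0, F => F
  | n + 1, F => exFmls n (.exFml F)

/-- Binds the `e` innermost variables and leaves the `k` outer ones in scope. -/
def LL.allLabs {k f : ℕ} : (e : ℕ) → LL σ (k + e) f → LL σ k f
  | 0, F => F
  | e + 1, F => allLabs e (.allLab F)

/-- Tensor product of negated atoms and a formula. -/
def LL.tensorNatoms {l f : ℕ} (as : List (Atom σ l f)) (G : LL σ l f) : LL σ l f :=
  as.foldr (fun a F => .tensor (.natom a) F) G

def LL.parAtoms {l f : ℕ} (as : List (Atom σ l f)) : LL σ l f :=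
  as.foldr (fun a F => .par (.atom a) F) .bot

/-- Ending in ⊤ closes the branch at once for a rule without premisses. -/
def LL.wths {l f : ℕ} (Fs : List (LL σ l f)) : LL σ l f := Fs.foldr .wth .top

/-- The bound label variable, below `e` quantifiers, for one of `k` outer or `e` inner labels. -/
def labIdx {k : ℕ} : (e : ℕ) → Fin k ⊕ Fin e → Fin (k + e)
  | 0, x => Sum.elim id Fin.elim0 x
  | e + 1, .inl i => (labIdx e (.inl i)).succ
  | e + 1, .inr j => Fin.cases 0 (fun j => (labIdx e (.inr j)).succ) j

/-- Values of the bound label variables, below `e` quantifiers. -/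
def extLab {k : ℕ} (lab : Fin k → ℕ) : (e : ℕ) → (Fin e → ℕ) → Fin (k + e) → ℕ
  | 0, _ => lab
  | e + 1, new => Fin.cons (new 0) (extLab lab e (Fin.tail new))

theorem extLab_labIdx {k : ℕ} (lab : Fin k → ℕ) : ∀ (e : ℕ) (new : Fin e → ℕ)
    (x : Fin k ⊕ Fin e), extLab lab e new (labIdx e x) = Sum.elim lab new x := by
  intro e
  induction e with
  | zero => rintro new (i | j) <;> [rfl; exact j.elim0]
  | succ e ih =>
    rintro new (i | j)
    · exact ih (Fin.tail new) (.inl i)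
    · refine Fin.cases rfl (fun j => ?_) j
      exact ih (Fin.tail new) (.inr j)

theorem extLab_mem {k : ℕ} (lab : Fin k → ℕ) : ∀ (e : ℕ) (new : Fin e → ℕ) (i : Fin (k + e)),
    extLab lab e new i ∈ Set.range lab ∪ Set.range new := by
  intro e
  induction e with
  | zero => exact fun new i => .inl ⟨i, rfl⟩
  | succ e ih =>
    intro new i
    refine Fin.cases (.inr ⟨0, rfl⟩) (fun i => ?_) i
    rcases ih (Fin.tail new) i with h | ⟨j, h⟩
    · exact .inl h
    · exact .inr ⟨j.succ, h⟩

/-- Atoms of a sequent whose labels and formulae are schematic. -/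
def schemaAtoms {l f m : ℕ} (r : σ.Rel) (args : Fin (σ.ar r + 1) → Fin l) (lab : Fin m → Fin l)
    (left right : List (Fin m × Fml σ.Mod f)) : List (Atom σ l f) :=
  .rel r (fun i => .bvar (args i)) ::
    (left.map (fun a => .lft (.bvar (lab a.1)) a.2) ++
      right.map fun a => .rght (.bvar (lab a.1)) a.2)

def LLSPremise.atoms {k e n : ℕ} (P : LLSPremise σ k e n) : List (Atom σ (k + e) n) :=
  schemaAtoms P.rel (fun i => labIdx e (P.args i)) (fun i => labIdx e (P.args i.succ))
    P.left P.right

def LLSRule.atoms (r : LLSRule σ) : List (Atom σ (σ.ar r.rel + 1) r.numFml) :=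
  schemaAtoms r.rel id id r.left r.right

/-- The part of the clause of a rule that generates the premisses. -/
def LLSRule.body (r : LLSRule σ) : LL σ (σ.ar r.rel + 1) r.numFml :=
  .allLabs r.numFresh (.wths (r.prems.map fun P => .parAtoms P.atoms))

/-- The clause of a rule. -/
def LLSRule.clause (r : LLSRule σ) : LL σ 0 0 :=
  .exLabs (σ.ar r.rel + 1) (.exFmls r.numFml (.tensorNatoms r.atoms r.body))

/-! ### The clause is a bipole without free state variables -/

theorem isMonopole_parAtoms {l f : ℕ} (as : List (Atom σ l f)) : IsMonopole (.parAtoms as) := by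
  induction as with
  | nil => exact .bot
  | cons a as ih => exact .par (.atom a) ih

theorem isMonopole_wths {l f : ℕ} {Fs : List (LL σ l f)} (h : ∀ F ∈ Fs, IsMonopole F) :
    IsMonopole (.wths Fs) := by
  induction Fs with
  | nil => exact .top
  | cons F Fs ih => exact .wth (h F (by simp)) (ih fun G hG => h G (by simp [hG]))

theorem isMonopole_allLabs {k f : ℕ} : ∀ (e : ℕ) {F : LL σ (k + e) f} (_ : IsMonopole F),
    IsMonopole (.allLabs e F) := by
  intro e
  induction e with
  | zero => exact fun h => h
  | succ e ih => exact fun h => ih (.allLab h)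

theorem LLSRule.isMonopole_body (r : LLSRule σ) : IsMonopole r.body := by
  refine isMonopole_allLabs _ (isMonopole_wths fun F hF => ?_)
  obtain ⟨P, -, rfl⟩ := List.mem_map.1 hF
  exact isMonopole_parAtoms _

theorem isBipolar_tensorNatoms {l f : ℕ} (as : List (Atom σ l f)) {G : LL σ l f}
    (hG : IsBipolar G) : IsBipolar (.tensorNatoms as G) := by
  induction as with
  | nil => exact hG
  | cons a as ih => exact .tensor (.natom a) ih

theorem isBipolar_exFmls {l : ℕ} : ∀ (n : ℕ) {F : LL σ l n} (_ : IsBipolar F),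
    IsBipolar (.exFmls n F) := by
  intro n
  induction n with
  | zero => exact fun h => h
  | succ n ih => exact fun h => ih (.exFml h)

theorem isBipolar_exLabs {f : ℕ} : ∀ (k : ℕ) {F : LL σ k f} (_ : IsBipolar F),
    IsBipolar (.exLabs k F) := by
  intro k
  induction k with
  | zero => exact fun h => h
  | succ k ih => exact fun h => ih (.exLab h)

theorem isPositive_exFmls {l : ℕ} : ∀ (n : ℕ) {F : LL σ l n} (_ : F.IsPositive),
    (LL.exFmls n F).IsPositive := by
  intro n
  induction n with
  | zero => exact fun h => h
  | succ n ih => exact fun _ => ih id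

theorem isPositive_exLabs {f : ℕ} : ∀ (k : ℕ) {F : LL σ k f} (_ : F.IsPositive),
    (LL.exLabs k F).IsPositive := by
  intro k
  induction k with
  | zero => exact fun h => h
  | succ k ih => exact fun _ => ih id

/-- Positivity holds even if there are no quantified formulae and no active formulae: the relation
atom is always present, so a tensor stands below the existential quantifiers. -/
theorem LLSRule.isBipole_clause (r : LLSRule σ) : IsBipole r.clause :=
  ⟨isPositive_exLabs _ (isPositive_exFmls _ id),
    isBipolar_exLabs _ (isBipolar_exFmls _ (isBipolar_tensorNatoms _ (.mono r.isMonopole_body)))⟩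

theorem freshLab_schemaAtoms {l f m y : ℕ} {r : σ.Rel} {args : Fin (σ.ar r + 1) → Fin l}
    {lab : Fin m → Fin l} {left right : List (Fin m × Fml σ.Mod f)} :
    ∀ a ∈ schemaAtoms r args lab left right, a.FreshLab y := by
  intro a ha
  simp only [schemaAtoms, List.mem_cons, List.mem_append, List.mem_map] at ha
  rcases ha with rfl | ⟨_, _, rfl⟩ | ⟨_, _, rfl⟩
  · exact fun _ => trivial
  · trivial
  · trivial

theorem freshLab_parAtoms {l f y : ℕ} {as : List (Atom σ l f)} (h : ∀ a ∈ as, a.FreshLab y) :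
    (LL.parAtoms as).FreshLab y := by
  induction as with
  | nil => trivial
  | cons a as ih => exact ⟨h a (by simp), ih fun b hb => h b (by simp [hb])⟩

theorem freshLab_tensorNatoms {l f y : ℕ} {as : List (Atom σ l f)} {G : LL σ l f}
    (h : ∀ a ∈ as, a.FreshLab y) (hG : G.FreshLab y) : (LL.tensorNatoms as G).FreshLab y := by
  induction as with
  | nil => exact hG
  | cons a as ih => exact ⟨h a (by simp), ih fun b hb => h b (by simp [hb])⟩

theorem freshLab_wths {l f y : ℕ} {Fs : List (LL σ l f)} (h : ∀ F ∈ Fs, F.FreshLab y) :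
    (LL.wths Fs).FreshLab y := by
  induction Fs with
  | nil => trivial
  | cons F Fs ih => exact ⟨h F (by simp), ih fun G hG => h G (by simp [hG])⟩

theorem freshLab_allLabs {k f y : ℕ} : ∀ (e : ℕ) {F : LL σ (k + e) f} (_ : F.FreshLab y),
    (LL.allLabs e F).FreshLab y := by
  intro e
  induction e with
  | zero => exact fun h => h
  | succ e ih => exact fun {F} h => ih (F := .allLab F) h

theorem freshLab_exFmls {l y : ℕ} : ∀ (n : ℕ) {F : LL σ l n} (_ : F.FreshLab y),
    (LL.exFmls n F).FreshLab y := by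
  intro n
  induction n with
  | zero => exact fun h => h
  | succ n ih => exact fun {F} h => ih (F := .exFml F) h

theorem freshLab_exLabs {f y : ℕ} : ∀ (k : ℕ) {F : LL σ k f} (_ : F.FreshLab y),
    (LL.exLabs k F).FreshLab y := by
  intro k
  induction k with
  | zero => exact fun h => h
  | succ k ih => exact fun {F} h => ih (F := .exLab F) h

theorem freshLab_wths_parAtoms {k e n y : ℕ} (Ps : List (LLSPremise σ k e n)) :
    (LL.wths (Ps.map fun P => .parAtoms P.atoms)).FreshLab y := by
  refine freshLab_wths fun F hF => ?_
  obtain ⟨P, -, rfl⟩ := List.mem_map.1 hF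
  exact freshLab_parAtoms freshLab_schemaAtoms

theorem LLSRule.freshLab_clause (r : LLSRule σ) (y : ℕ) : r.clause.FreshLab y :=
  freshLab_exLabs _ (freshLab_exFmls _ (freshLab_tensorNatoms freshLab_schemaAtoms
    (freshLab_allLabs _ (freshLab_wths_parAtoms _))))

/-! ### Substitution and the derived connectives -/

/-- Instantiation of all variables in scope. -/
abbrev LL.close {l f : ℕ} (lab : Fin l → ℕ) (fm : Fin f → Fml σ.Mod 0) (F : LL σ l f) : LL σ 0 0 :=
  F.subst id (fun i => .name (lab i)) fm

abbrev Atom.close {l f : ℕ} (lab : Fin l → ℕ) (fm : Fin f → Fml σ.Mod 0) (a : Atom σ l f) :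
    Atom σ 0 0 :=
  a.subst id (fun i => .name (lab i)) fm

section close
variable {l f : ℕ} (lab : Fin l → ℕ) (fm : Fin f → Fml σ.Mod 0)

theorem close_tensorNatoms (as : List (Atom σ l f)) (G : LL σ l f) :
    (LL.tensorNatoms as G).close lab fm =
      .tensorNatoms (as.map (Atom.close lab fm)) (G.close lab fm) := by
  induction as with
  | nil => rfl
  | cons a as ih => exact congrArg (LL.tensor _) ih

theorem close_parAtoms (as : List (Atom σ l f)) :
    (LL.parAtoms as).close lab fm = .parAtoms (as.map (Atom.close lab fm)) := by
  induction as with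
  | nil => rfl
  | cons a as ih => exact congrArg (LL.par _) ih

theorem close_wths (Fs : List (LL σ l f)) :
    (LL.wths Fs).close lab fm = .wths (Fs.map (LL.close lab fm)) := by
  induction Fs with
  | nil => rfl
  | cons a as ih => exact congrArg (LL.wth _) ih

/-- Instantiating the innermost variable last amounts to extending the valuation at index 0, which
drives the inductions over blocks of quantifiers. -/
theorem close_instLab (F : LL σ (l + 1) f) (x : ℕ) :
    (F.subst id (liftLab fun i => .name (lab i)) fm).instLab x =
      F.close (Fin.cons x lab : Fin (l + 1) → ℕ) fm := by
  rw [LL.instLab, LL.subst_subst]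
  congr 1
  · funext i
    refine Fin.cases ?_ (fun i => ?_) i <;> simp [liftLab, LTm.subst]
  · funext i
    exact Fml.subst_var _

theorem close_instFml (F : LL σ l (f + 1)) (A : Fml σ.Mod 0) :
    (F.subst id (fun i => .name (lab i)) (liftFml fm)).instFml A =
      F.close lab (Fin.cons A fm : Fin (f + 1) → _) := by
  rw [LL.instFml, LL.subst_subst]
  congr 1
  funext i
  refine Fin.cases ?_ (fun i => ?_) i
  · simp [liftFml, Fml.subst]
  · simp only [liftFml, Fin.cons_succ, Fml.subst_subst, Fml.subst]
    -- There is only one substitution out of the empty set of variables.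
    exact (congrArg (Fml.subst · (fm i)) (Subsingleton.elim _ _)).trans (Fml.subst_var _)

end close

theorem isNegative_allLabs {k f : ℕ} : ∀ (e : ℕ) {F : LL σ (k + e) f} (_ : F.IsNegative),
    (LL.allLabs e F).IsNegative := by
  intro e
  induction e with
  | zero => exact fun h => h
  | succ e ih => exact fun _ => ih trivial

theorem isNegative_wths {l f : ℕ} (Fs : List (LL σ l f)) : (LL.wths Fs).IsNegative := by
  cases Fs <;> trivial

/-! ### Derivability of the derived connectives -/

section phase
variable {H : Set (Set (LL σ 0 0) × Multiset (LL σ 0 0))} {Θ : Set (LL σ 0 0)}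
  {Γ : Multiset (LL σ 0 0)}

/-- Leaves are border sequents, so any other judgement is the conclusion of a rule; this starts
every inversion below. -/
theorem Derivable.exists_rule {j : Judgement σ} (h : Derivable PhaseRule (leaves H) j)
    (hj : ∀ Θ Γ, j ≠ .up Θ Γ []) :
    ∃ ps, PhaseRule ps j ∧ ∀ p ∈ ps, Derivable PhaseRule (leaves H) p := by
  cases h with
  | hyp h =>
    obtain ⟨b, -, rfl⟩ := h
    exact absurd rfl (hj _ _)
  | rule h hp => exact ⟨_, h, hp⟩

theorem derivable_exLab_iff {F : LL σ 1 0} :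
    Derivable PhaseRule (leaves H) (.down Θ Γ (.exLab F)) ↔
      ∃ x, Derivable PhaseRule (leaves H) (.down Θ Γ (F.instLab x)) := by
  constructor
  · intro h
    obtain ⟨ps, h, hp⟩ := h.exists_rule (by simp)
    cases h with
    | exLab x => exact ⟨x, hp _ (by simp)⟩
    | release h => exact h.elim
  · rintro ⟨x, h⟩
    exact .rule (.exLab x) fun j hj => List.mem_singleton.1 hj ▸ h

theorem derivable_exFml_iff {F : LL σ 0 1} :
    Derivable PhaseRule (leaves H) (.down Θ Γ (.exFml F)) ↔
      ∃ A, Derivable PhaseRule (leaves H) (.down Θ Γ (F.instFml A)) := by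
  constructor
  · intro h
    obtain ⟨ps, h, hp⟩ := h.exists_rule (by simp)
    cases h with
    | exFml A => exact ⟨A, hp _ (by simp)⟩
    | release h => exact h.elim
  · rintro ⟨A, h⟩
    exact .rule (.exFml A) fun j hj => List.mem_singleton.1 hj ▸ h

theorem derivable_exLabs_iff : ∀ (k : ℕ) {F : LL σ k 0},
    Derivable PhaseRule (leaves H) (.down Θ Γ (.exLabs k F)) ↔
      ∃ lab : Fin k → ℕ, Derivable PhaseRule (leaves H) (.down Θ Γ (F.close lab Fml.var)) := by
  intro k
  induction k with
  | zero =>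
    intro F
    have e : ∀ lab, F.close lab Fml.var = F := fun lab => by
      rw [LL.close, show (fun i => LTm.name (lab i) : Fin 0 → LTm 0) = LTm.bvar from
        Subsingleton.elim _ _, LL.subst_id]
    simp [e, LL.exLabs]
  | succ k ih =>
    intro F
    rw [LL.exLabs, ih]
    have e : ∀ lab : Fin k → ℕ, LL.close lab Fml.var (.exLab F) =
        .exLab (F.subst id (liftLab fun i => .name (lab i)) Fml.var) := fun _ => rfl
    simp only [e, derivable_exLab_iff, close_instLab]
    exact ⟨fun ⟨lab, x, h⟩ => ⟨_, h⟩, fun ⟨lab, h⟩ =>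
      ⟨Fin.tail lab, lab 0, by rwa [Fin.cons_self_tail]⟩⟩

theorem derivable_exFmls_iff {l : ℕ} (lab : Fin l → ℕ) : ∀ (n : ℕ) {F : LL σ l n},
    Derivable PhaseRule (leaves H) (.down Θ Γ ((LL.exFmls n F).close lab Fml.var)) ↔
      ∃ fm, Derivable PhaseRule (leaves H) (.down Θ Γ (F.close lab fm)) := by
  intro n
  induction n with
  | zero =>
    intro F
    have e : ∀ fm, fm = (Fml.var : Fin 0 → Fml σ.Mod 0) := fun fm => Subsingleton.elim _ _
    exact ⟨fun h => ⟨_, h⟩, fun ⟨fm, h⟩ => e fm ▸ h⟩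
  | succ n ih =>
    intro F
    rw [LL.exFmls, ih]
    have e : ∀ fm, LL.close lab fm (.exFml F) =
        .exFml (F.subst id (fun i => .name (lab i)) (liftFml fm)) := fun _ => rfl
    simp only [e, derivable_exFml_iff, close_instFml]
    exact ⟨fun ⟨fm, A, h⟩ => ⟨_, h⟩, fun ⟨fm, h⟩ =>
      ⟨Fin.tail fm, fm 0, by rwa [Fin.cons_self_tail]⟩⟩

/-- Without atoms in `Θ`, only `init₁` can close the left branch, which forces the splitting of the
linear context. -/
theorem derivable_natom_tensor_iff (hΘ : ∀ a, .atom a ∉ Θ) {a : Atom σ 0 0} {F : LL σ 0 0} :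
    Derivable PhaseRule (leaves H) (.down Θ Γ (.tensor (.natom a) F)) ↔
      ∃ Γ', Γ = .atom a ::ₘ Γ' ∧ Derivable PhaseRule (leaves H) (.down Θ Γ' F) := by
  constructor
  · intro h
    obtain ⟨ps, h, hp⟩ := h.exists_rule (by simp)
    cases h with
    | @tensor _ Γ₁ Γ₂ =>
      obtain ⟨ps', h', -⟩ := (hp (.down Θ Γ₁ (.natom a)) (by simp)).exists_rule (by simp)
      refine ⟨Γ₂, ?_, hp _ (by simp)⟩
      cases h' with
      | init₁ => exact Multiset.singleton_add _ _
      | init₂ ha => exact absurd ha (hΘ a)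
      | release h => exact h.elim
    | release h => exact h.elim
  · rintro ⟨Γ', rfl, h⟩
    rw [← Multiset.singleton_add]
    refine .rule .tensor fun j hj => ?_
    simp only [List.mem_cons, List.not_mem_nil, or_false] at hj
    rcases hj with rfl | rfl
    · exact .rule .init₁ (by simp)
    · exact h

theorem derivable_tensorNatoms_iff (hΘ : ∀ a, .atom a ∉ Θ) {as : List (Atom σ 0 0)}
    {F : LL σ 0 0} : ∀ {Γ : Multiset (LL σ 0 0)},
    Derivable PhaseRule (leaves H) (.down Θ Γ (.tensorNatoms as F)) ↔
      ∃ Γ', Γ = (as.map LL.atom : List _) + Γ' ∧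
        Derivable PhaseRule (leaves H) (.down Θ Γ' F) := by
  induction as with
  | nil => simp [LL.tensorNatoms]
  | cons a as ih =>
    intro Γ
    refine (derivable_natom_tensor_iff hΘ).trans ?_
    constructor
    · rintro ⟨Γ', rfl, h⟩
      obtain ⟨Γ'', rfl, h'⟩ := ih.1 h
      exact ⟨Γ'', by rw [List.map_cons, ← Multiset.cons_coe, Multiset.cons_add], h'⟩
    · rintro ⟨Γ', rfl, h⟩
      exact ⟨_, by rw [List.map_cons, ← Multiset.cons_coe, Multiset.cons_add],
        ih.2 ⟨Γ', rfl, h⟩⟩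

theorem derivable_release_iff {F : LL σ 0 0} (hF : F.IsNegative) :
    Derivable PhaseRule (leaves H) (.down Θ Γ F) ↔
      Derivable PhaseRule (leaves H) (.up Θ Γ [F]) := by
  constructor
  · intro h
    obtain ⟨ps, h, hp⟩ := h.exists_rule (by simp)
    cases h with
    | release => exact hp _ (by simp)
    | _ => exact hF.elim
  · exact fun h => .rule (.release hF) fun j hj => List.mem_singleton.1 hj ▸ h

theorem derivable_wths_iff {Fs : List (LL σ 0 0)} :
    Derivable PhaseRule (leaves H) (.up Θ Γ [.wths Fs]) ↔
      ∀ F ∈ Fs, Derivable PhaseRule (leaves H) (.up Θ Γ [F]) := by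
  induction Fs with
  | nil => exact ⟨by simp, fun _ => .rule .top (by simp)⟩
  | cons F Fs ih =>
    rw [List.forall_mem_cons, ← ih]
    constructor
    · intro h
      obtain ⟨ps, h, hp⟩ := h.exists_rule (by simp)
      change PhaseRule ps (.up Θ Γ [.wth F (.wths Fs)]) at h
      cases h with
      | wth => exact ⟨hp _ (by simp), hp _ (by simp)⟩
      | store h => exact (h.elim (fun h => h trivial) id).elim
    · rintro ⟨h₁, h₂⟩
      refine .rule .wth fun j hj => ?_
      simp only [List.mem_cons, List.not_mem_nil, or_false] at hj
      rcases hj with rfl | rfl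
      · exact h₁
      · exact h₂

theorem derivable_store_atom_iff {a : Atom σ 0 0} {L : List (LL σ 0 0)} :
    Derivable PhaseRule (leaves H) (.up Θ Γ (.atom a :: L)) ↔
      Derivable PhaseRule (leaves H) (.up Θ (.atom a ::ₘ Γ) L) := by
  constructor
  · intro h
    obtain ⟨ps, h, hp⟩ := h.exists_rule (by simp)
    cases h with
    | store => exact hp _ (by simp)
  · exact fun h => .rule (.store (.inr trivial)) fun j hj => List.mem_singleton.1 hj ▸ h

theorem derivable_par_iff {F G : LL σ 0 0} {L : List (LL σ 0 0)} :
    Derivable PhaseRule (leaves H) (.up Θ Γ (.par F G :: L)) ↔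
      Derivable PhaseRule (leaves H) (.up Θ Γ (F :: G :: L)) := by
  constructor
  · intro h
    obtain ⟨ps, h, hp⟩ := h.exists_rule (by simp)
    cases h with
    | par => exact hp _ (by simp)
    | store h => exact (h.elim (fun h => h trivial) id).elim
  · exact fun h => .rule .par fun j hj => List.mem_singleton.1 hj ▸ h

theorem derivable_parAtoms_iff {as : List (Atom σ 0 0)} : ∀ {Γ : Multiset (LL σ 0 0)},
    Derivable PhaseRule (leaves H) (.up Θ Γ [.parAtoms as]) ↔
      (Θ, (as.map LL.atom : List _) + Γ) ∈ H := by
  induction as with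
  | nil =>
    intro Γ
    rw [← derivable_up_nil_iff]
    constructor
    · intro h
      obtain ⟨ps, h, hp⟩ := h.exists_rule (by simp)
      change PhaseRule ps (.up Θ Γ [.bot]) at h
      cases h with
      | bot => simpa using hp _ (by simp)
      | store h => exact (h.elim (fun h => h trivial) id).elim
    · intro h
      refine .rule .bot fun j hj => List.mem_singleton.1 hj ▸ ?_
      simpa using h
  | cons a as ih =>
    intro Γ
    refine derivable_par_iff.trans (derivable_store_atom_iff.trans (ih.trans ?_))
    rw [List.map_cons, ← Multiset.cons_coe, Multiset.cons_add, Multiset.add_cons]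

/-! ### Blocks of universal quantifiers over labels -/

theorem freshLab_subst_liftLab {l f y : ℕ} {lab : Fin l → ℕ} {fm : Fin f → Fml σ.Mod 0}
    {F : LL σ (l + 1) f} (hF : F.FreshLab y) (hy : y ∉ Set.range lab) :
    (F.subst id (liftLab fun i => (.name (lab i) : LTm 0)) fm).FreshLab y := by
  have h : ∀ i, (LTm.name (lab i) : LTm 0).FreshLab y := fun i h => hy ⟨i, h.symm⟩
  exact hF.subst (y' := y) (fun _ h => h) (freshLab_liftLab h) fm

theorem derivable_allLabs {k f : ℕ} {lab : Fin k → ℕ} {fm : Fin f → Fml σ.Mod 0}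
    (hΘ : ∀ G ∈ Θ, ∀ y, G.FreshLab y) : ∀ (e : ℕ) {F : LL σ (k + e) f} {new : Fin e → ℕ}
    (_ : ∀ y, F.FreshLab y) (_ : Function.Injective new) (_ : ∀ j, new j ∉ Set.range lab)
    (_ : ∀ j, ∀ G ∈ Γ, G.FreshLab (new j))
    (_ : Derivable PhaseRule (leaves H) (.up Θ Γ [F.close (extLab lab e new) fm])),
    Derivable PhaseRule (leaves H) (.up Θ Γ [(LL.allLabs e F).close lab fm]) := by
  intro e
  induction e with
  | zero => exact fun _ _ _ _ h => h
  | succ e ih =>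
    intro F new hF hnew hlab hΓ h
    refine ih (F := .allLab F) (new := Fin.tail new) hF
      (hnew.comp (Fin.succ_injective _)) (fun j => hlab j.succ) (fun j => hΓ j.succ) ?_
    -- `new 0` instantiates the innermost quantifier, hence comes last; it must differ from the
    -- outer labels and, by injectivity, from the eigenvariables already introduced.
    have hy : new 0 ∉ Set.range (extLab lab e (Fin.tail new)) := by
      rintro ⟨i, hi⟩
      rcases extLab_mem lab e (Fin.tail new) i with h | ⟨j, h⟩
      · exact hlab 0 (hi ▸ h)
      · exact absurd (hnew (h.trans hi)) (Fin.succ_ne_zero j)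
    refine .rule (.allLab (new 0) (fun G hG => hΘ G hG _) (hΓ 0) (by simp)
      (freshLab_subst_liftLab (hF (new 0)) hy)) ?_
    intro j hj
    rw [List.mem_singleton.1 hj, close_instLab]
    exact h

/-- The eigenvariable of a quantifier can be chosen fresh. -/
theorem exists_derivable_of_allLab (hH : RenamingClosed H) (hΘ : ∀ G ∈ Θ, ∀ y, G.FreshLab y)
    {F : LL σ 1 0} (h : Derivable PhaseRule (leaves H) (.up Θ Γ [.allLab F])) {y : ℕ}
    (hΓ : ∀ G ∈ Γ, G.FreshLab y) (hF : F.FreshLab y) :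
    Derivable PhaseRule (leaves H) (.up Θ Γ [F.instLab y]) := by
  obtain ⟨ps, h, hp⟩ := h.exists_rule (by simp)
  cases h with
  | allLab x hΘ' hΓ' _ hF' =>
    -- Neither `x` nor `y` occurs in `Θ`, `Γ` or `F`, so the swap changes nothing but the instance,
    -- where `x` becomes `y`.
    have h := derivable_phaseRule_rename hH (Equiv.swap x y)
      (hp _ (List.mem_singleton_self _))
    have e₁ : LL.rename (Equiv.swap x y) '' Θ = Θ := by
      conv_rhs => rw [← Set.image_id Θ]
      exact Set.image_congr fun G hG => LL.rename_swap (hΘ G hG x) (hΘ G hG y)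
    have e₂ : Γ.map (LL.rename (Equiv.swap x y)) = Γ :=
      (Multiset.map_congr rfl fun G hG => LL.rename_swap (hΓ' G hG) (hΓ G hG)).trans
        (Multiset.map_id _)
    have e₃ : F.subst (Equiv.swap x y) LTm.bvar Fml.var = F := by
      refine (LL.subst_congr (g' := id) fun z => ?_).trans F.subst_id
      by_cases hx : z = x
      · exact .inr (hx ▸ hF')
      by_cases hy : z = y
      · exact .inr (hy ▸ hF)
      exact .inl (Equiv.swap_apply_of_ne_of_ne hx hy)
    simpa only [Judgement.rename, List.map, e₁, e₂, e₃, LL.rename_instLab,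
      Equiv.swap_apply_left] using h
  | store h => exact (h.elim (fun h => h trivial) id).elim

/-- `B` will be the set of labels of the whole conclusion. The given eigenvariables may clash with
labels of consumed atoms or, where a bound variable does not occur, with each other; they are
exchanged one by one for new names outside `B`. -/
theorem exists_derivable_of_allLabs {k f : ℕ} {lab : Fin k → ℕ} {fm : Fin f → Fml σ.Mod 0}
    (hH : RenamingClosed H) (hΘ : ∀ G ∈ Θ, ∀ y, G.FreshLab y) {B : Set ℕ} (hB : B.Finite)
    (hlab : Set.range lab ⊆ B) (hΓ : ∀ y ∉ B, ∀ G ∈ Γ, G.FreshLab y) :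
    ∀ (e : ℕ) {F : LL σ (k + e) f} (_ : ∀ y, F.FreshLab y)
    (_ : Derivable PhaseRule (leaves H) (.up Θ Γ [(LL.allLabs e F).close lab fm])),
    ∃ new : Fin e → ℕ, Function.Injective new ∧ (∀ j, new j ∉ B) ∧
      Derivable PhaseRule (leaves H) (.up Θ Γ [F.close (extLab lab e new) fm]) := by
  intro e
  induction e with
  | zero => exact fun _ h => ⟨Fin.elim0, fun i => i.elim0, fun i => i.elim0, h⟩
  | succ e ih =>
    intro F hF h
    obtain ⟨new, hinj, hnew, h⟩ := ih (F := .allLab F) hF h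
    obtain ⟨y, hy⟩ := (hB.union (Set.finite_range new)).exists_notMem
    refine ⟨Fin.cons y new, ?_, ?_, ?_⟩
    · exact Fin.cons_injective_iff.2 ⟨fun h => hy (.inr h), hinj⟩
    · exact Fin.cases (fun h => hy (.inl h)) hnew
    · have hy' : y ∉ Set.range (extLab lab e new) := by
        rintro ⟨i, rfl⟩
        exact hy ((extLab_mem lab e new i).imp_left fun h => hlab h)
      have := exists_derivable_of_allLab hH hΘ h (hΓ y fun h => hy (.inl h))
        (freshLab_subst_liftLab (hF y) hy')
      rwa [close_instLab] at this

end phase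

/-! ### Adequacy of the clause -/

/-- The multiset `⌊X⌋, ⌈Y⌉`. -/
def encCtx (X Y : Multiset (ℕ × Fml σ.Mod 0)) : Multiset (LL σ 0 0) :=
  X.map (fun a => .atom (.lft (.name a.1) a.2)) + Y.map (fun a => .atom (.rght (.name a.1) a.2))

theorem encCtx_add (X X' Y Y' : Multiset (ℕ × Fml σ.Mod 0)) :
    encCtx (X + X') (Y + Y') = encCtx X Y + encCtx X' Y' := by
  simp only [encCtx, Multiset.map_add]
  abel

/-- Partial inverse of the encoding of left formulae; filtering with it recovers the multiset `X`
from `encCtx X Y`. -/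
def LL.lft? : LL σ 0 0 → Option (ℕ × Fml σ.Mod 0)
  | .atom (.lft (.name x) A) => some (x, A)
  | _ => none

def LL.rght? : LL σ 0 0 → Option (ℕ × Fml σ.Mod 0)
  | .atom (.rght (.name x) A) => some (x, A)
  | _ => none

theorem filterMap_lft?_encCtx (X Y : Multiset (ℕ × Fml σ.Mod 0)) :
    (encCtx X Y).filterMap LL.lft? = X := by
  rw [encCtx, Multiset.filterMap_add, Multiset.filterMap_map, Multiset.filterMap_map]
  have h₁ : (LL.lft? ∘ fun a : ℕ × Fml σ.Mod 0 => .atom (.lft (.name a.1) a.2)) = some := rfl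
  have h₂ : (LL.lft? ∘ fun a : ℕ × Fml σ.Mod 0 => .atom (.rght (.name a.1) a.2)) =
    fun _ => none := rfl
  rw [h₁, h₂, Multiset.filterMap_some]
  induction Y using Multiset.induction <;> simp_all

theorem filterMap_rght?_encCtx (X Y : Multiset (ℕ × Fml σ.Mod 0)) :
    (encCtx X Y).filterMap LL.rght? = Y := by
  rw [encCtx, Multiset.filterMap_add, Multiset.filterMap_map, Multiset.filterMap_map]
  have h₁ : (LL.rght? ∘ fun a : ℕ × Fml σ.Mod 0 => .atom (.rght (.name a.1) a.2)) = some := rfl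
  have h₂ : (LL.rght? ∘ fun a : ℕ × Fml σ.Mod 0 => .atom (.lft (.name a.1) a.2)) =
    fun _ => none := rfl
  rw [h₁, h₂, Multiset.filterMap_some]
  induction X using Multiset.induction <;> simp_all

/-- A part of an encoded context is an encoded context. -/
theorem encCtx_eq_add {X X' Y Y' : Multiset (ℕ × Fml σ.Mod 0)} {Γ : Multiset (LL σ 0 0)}
    (h : encCtx X Y = encCtx X' Y' + Γ) :
    ∃ X₀ Y₀, X = X₀ + X' ∧ Y = Y₀ + Y' ∧ Γ = encCtx X₀ Y₀ := by
  have h₁ := congrArg (Multiset.filterMap LL.lft?) h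
  have h₂ := congrArg (Multiset.filterMap LL.rght?) h
  rw [Multiset.filterMap_add, filterMap_lft?_encCtx, filterMap_lft?_encCtx, add_comm] at h₁
  rw [Multiset.filterMap_add, filterMap_rght?_encCtx, filterMap_rght?_encCtx, add_comm] at h₂
  refine ⟨_, _, h₁, h₂, ?_⟩
  rw [h₁, h₂, encCtx_add, add_comm] at h
  exact (add_left_cancel h).symm

theorem LSeq.enc_eq (S : LSeq σ) : S.enc = S.encRel ::ₘ encCtx S.left S.right := rfl

theorem map_close_schemaAtoms {l f m : ℕ} (r : σ.Rel) (args : Fin (σ.ar r + 1) → Fin l)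
    (lab : Fin m → Fin l) (left right : List (Fin m × Fml σ.Mod f)) (v : Fin l → ℕ)
    (fm : Fin f → Fml σ.Mod 0) :
    (((schemaAtoms r args lab left right).map (Atom.close v fm)).map LL.atom :
        Multiset (LL σ 0 0)) =
      .atom (.rel r fun i => .name (v (args i))) ::ₘ
        encCtx (left.map fun a => (v (lab a.1), a.2.subst fm) : List _)
          (right.map fun a => (v (lab a.1), a.2.subst fm) : List _) := by
  simp [schemaAtoms, encCtx, Atom.subst, LTm.subst, Function.comp_def]

theorem LLSPremise.enc_inst {k e n : ℕ} (P : LLSPremise σ k e n) (lab : Fin k → ℕ)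
    (new : Fin e → ℕ) (fm : Fin n → Fml σ.Mod 0) (X Y : Multiset (ℕ × Fml σ.Mod 0)) :
    (P.inst lab new fm X Y).enc =
      ((P.atoms.map (Atom.close (extLab lab e new) fm)).map LL.atom : List _) + encCtx X Y := by
  rw [LLSPremise.atoms, map_close_schemaAtoms, LSeq.enc_eq, Multiset.cons_add]
  simp only [extLab_labIdx]
  congr 1
  rw [add_comm, ← encCtx_add]
  rfl

theorem LLSRule.enc_concl (r : LLSRule σ) (lab : Fin (σ.ar r.rel + 1) → ℕ)
    (fm : Fin r.numFml → Fml σ.Mod 0) (X Y : Multiset (ℕ × Fml σ.Mod 0)) :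
    (r.concl lab fm X Y).enc =
      ((r.atoms.map (Atom.close lab fm)).map LL.atom : List _) + encCtx X Y := by
  rw [LLSRule.atoms, map_close_schemaAtoms, LSeq.enc_eq, Multiset.cons_add]
  congr 1
  rw [add_comm, ← encCtx_add]
  rfl

/-- An encoding has exactly one relation atom, so the one demanded by the rule must be that of `S`;
this identifies the relation symbol and the labels. Cancelling it leaves a decomposition of an
encoded context. -/
theorem LLSRule.exists_eq_concl {r : LLSRule σ} {lab : Fin (σ.ar r.rel + 1) → ℕ}
    {fm : Fin r.numFml → Fml σ.Mod 0} {S : LSeq σ} {Γ : Multiset (LL σ 0 0)}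
    (h : S.enc = ((r.atoms.map (Atom.close lab fm)).map LL.atom : List _) + Γ) :
    ∃ X Y, S = r.concl lab fm X Y ∧ Γ = encCtx X Y := by
  rw [LLSRule.atoms, map_close_schemaAtoms, LSeq.enc_eq, Multiset.cons_add] at h
  have hmem := h.symm ▸ Multiset.mem_cons_self (LL.atom (.rel r.rel fun i => .name (lab i))) _
  obtain ⟨rel, args, left, right⟩ := S
  have hrel : LL.atom (.rel r.rel fun i => .name (lab i)) =
      LSeq.encRel ⟨rel, args, left, right⟩ := by
    rcases Multiset.mem_cons.1 hmem with h | h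
    · exact h
    -- An encoded context contains no relation atom.
    · simp [encCtx] at h
  simp only [LSeq.encRel, LL.atom.injEq, Atom.rel.injEq] at hrel
  obtain ⟨hr, ha⟩ := hrel
  subst hr
  have ha' : args = lab := by
    funext i
    have := congrFun (eq_of_heq ha) i
    exact (LTm.name.inj this).symm
  subst ha'
  obtain ⟨X, Y, rfl, rfl, rfl⟩ := encCtx_eq_add ((Multiset.cons_inj_right _).1 h)
  exact ⟨X, Y, rfl, rfl⟩

theorem freshLab_encCtx {X Y : Multiset (ℕ × Fml σ.Mod 0)} {y : ℕ}
    (h : ∀ A, (y, A) ∉ X ∧ (y, A) ∉ Y) : ∀ G ∈ encCtx X Y, G.FreshLab y := by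
  intro G hG
  simp only [encCtx, Multiset.mem_add, Multiset.mem_map] at hG
  rcases hG with ⟨⟨x, A⟩, hA, rfl⟩ | ⟨⟨x, A⟩, hA, rfl⟩
  · rintro rfl
    exact (h A).1 hA
  · rintro rfl
    exact (h A).2 hA

theorem LSeq.finite_labels (S : LSeq σ) : S.labels.Finite := by
  refine (Set.finite_range _).union ?_
  refine ((((S.left + S.right).map Prod.fst).finite_toSet)).subset ?_
  rintro x ⟨A, hA⟩
  exact Multiset.mem_map.2 ⟨(x, A), Multiset.mem_add.2 hA, rfl⟩

theorem LLSRule.freshLab_of_notMem_labels {r : LLSRule σ} {lab : Fin (σ.ar r.rel + 1) → ℕ}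
    {fm : Fin r.numFml → Fml σ.Mod 0} {X Y : Multiset (ℕ × Fml σ.Mod 0)} {y : ℕ}
    (hy : y ∉ (r.concl lab fm X Y).labels) : ∀ G ∈ encCtx X Y, G.FreshLab y :=
  freshLab_encCtx fun A =>
    ⟨fun h => hy (.inr ⟨A, .inl (Multiset.mem_add.2 (.inl h))⟩),
      fun h => hy (.inr ⟨A, .inr (Multiset.mem_add.2 (.inl h))⟩)⟩

theorem LLSRule.derivable_premisses_iff {H : Set (Set (LL σ 0 0) × Multiset (LL σ 0 0))}
    {Θ : Set (LL σ 0 0)} {k e n : ℕ} {Ps : List (LLSPremise σ k e n)} {lab : Fin k → ℕ}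
    {new : Fin e → ℕ} {fm : Fin n → Fml σ.Mod 0} {X Y : Multiset (ℕ × Fml σ.Mod 0)} :
    Derivable PhaseRule (leaves H) (.up Θ (encCtx X Y)
      [(LL.wths (Ps.map fun P => .parAtoms P.atoms)).close (extLab lab e new) fm]) ↔
    ∀ p ∈ Ps.map fun P => P.inst lab new fm X Y, (Θ, p.enc) ∈ H := by
  simp [close_wths, derivable_wths_iff, close_parAtoms, derivable_parAtoms_iff,
    LLSPremise.enc_inst]

/-- Inverting the connectives of the clause in turn reduces both sides to a choice of labels,
formulae, side context and eigenvariables. Renaming closure is used only from LLF to the rule, to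
make the eigenvariables fresh for the entire conclusion. -/
theorem LLSRule.adequateClause {Θ : Set (LL σ 0 0)} (hΘ : ∀ G ∈ Θ, ∀ y, G.FreshLab y)
    (hΘ' : ∀ a, .atom a ∉ Θ) (r : LLSRule σ) : AdequateClause Θ r r.clause := by
  intro H hH S
  change _ ↔ Derivable PhaseRule (leaves H) _
  rw [LLSRule.clause, derivable_exLabs_iff]
  simp only [derivable_exFmls_iff, close_tensorNatoms, derivable_tensorNatoms_iff hΘ']
  have hneg : ∀ lab fm, (r.body.close lab fm).IsNegative := fun lab fm =>
    LL.isNegative_subst.2 (isNegative_allLabs _ (isNegative_wths _))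
  simp only [derivable_release_iff (hneg _ _)]
  constructor
  · rintro ⟨ps, ⟨lab, new, fm, X, Y, rfl, hinj, hnew, rfl⟩, hps⟩
    refine ⟨lab, fm, encCtx X Y, r.enc_concl lab fm X Y, ?_⟩
    exact derivable_allLabs hΘ _ (fun _ => freshLab_wths_parAtoms _) hinj
      (fun j h => hnew j (.inl h)) (fun j => freshLab_of_notMem_labels (hnew j))
      (derivable_premisses_iff.2 hps)
  · rintro ⟨lab, fm, Γ, hS, h⟩
    obtain ⟨X, Y, rfl, rfl⟩ := exists_eq_concl hS
    obtain ⟨new, hinj, hnew, h⟩ := exists_derivable_of_allLabs hH hΘ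
      (LSeq.finite_labels (r.concl lab fm X Y)) Set.subset_union_left
      (fun y hy => freshLab_of_notMem_labels hy) _ (fun _ => freshLab_wths_parAtoms _) h
    exact ⟨_, ⟨lab, new, fm, X, Y, rfl, hinj, hnew, rfl⟩, derivable_premisses_iff.1 h⟩

theorem isAdequateSpec_clause (L₀ : Set (LLSRule σ)) : IsAdequateSpec L₀ LLSRule.clause := by
  refine fun r _ => ⟨r.isBipole_clause, r.freshLab_clause, r.adequateClause ?_ ?_⟩
  · rintro _ ⟨r, -, rfl⟩
    exact r.freshLab_clause
  · rintro a ⟨r, -, hr⟩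
    exact r.isBipole_clause.1.not_isAtom (hr ▸ trivial)

end LLSpec

/-! ### The main theorem -/

theorem mainTheorem12 (σ : LLSpec.Signature) (L : Set (LLSpec.LLSRule σ)) (S : LLSpec.LSeq σ) :
    (LLSpec.Provable L S ↔
      ∃ L₀ : Set (LLSpec.LLSRule σ), L₀ ⊆ L ∧ L₀.Finite ∧
        ∃ spec : LLSpec.LLSRule σ → LLSpec.LL σ 0 0, LLSpec.IsAdequateSpec L₀ spec ∧
          LLSpec.LLFProvable (S.judgement (spec '' L₀))) ∧
    (∀ L₀ : Set (LLSpec.LLSRule σ), L₀ ⊆ L → L₀.Finite →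
      (∃ spec : LLSpec.LLSRule σ → LLSpec.LL σ 0 0, LLSpec.IsAdequateSpec L₀ spec) ∧
      ∀ spec : LLSpec.LLSRule σ → LLSpec.LL σ 0 0, LLSpec.IsAdequateSpec L₀ spec →
        (LLSpec.LLFProvable (S.judgement (spec '' L₀)) ↔ LLSpec.Provable L₀ S)) := by
  refine ⟨⟨fun h => ?_, ?_⟩, fun L₀ _ _ =>
    ⟨⟨_, LLSpec.isAdequateSpec_clause L₀⟩, fun spec h => h.llfProvable_iff⟩⟩
  · obtain ⟨L₀, hL, hfin, h₀⟩ := h.exists_finite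
    have hs := LLSpec.isAdequateSpec_clause L₀
    exact ⟨L₀, hL, hfin, _, hs, hs.llfProvable_iff.2 h₀⟩
  · rintro ⟨L₀, hL, -, spec, hs, h⟩
    exact (hs.llfProvable_iff.1 h).mono hL
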